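/- Work in the one-sorted language of valued fields, i.e. the language of rings $\{+,\cdot,-,0,1\}$ together with a binary predicate $x \mathrel{\mathrm{div}} y$, interpreted in a valued field as $v(x)\le v(y)$. A subset $A$ of a structure $M$ is called uniformly stably embedded in $M$ if for every parameter-free formula $\varphi(x;t)$ (with $x$, $t$ finite tuples of variables) there is a parameter-free formula $\chi(x;s)$ such that for every tuple $b$ of elements of $M$ there is a tuple $a$ of elements of $A$ with $\varphi(A,b)=\chi(A,a)$, where $\varphi(A,b)$ denotes the set of tuples $x$ of elements of $A$ with $M\models\varphi(x,b)$, and similarly for $\chi(A,a)$. Let $k$ be any algebraically closed field (of any characteristic), and let $K=k((t^{\mathbb R}))$ be the Hahn field of formal series $\sum_{\gamma\in\mathbb R}c_\gamma t^\gamma$ with coefficients in $k$ and well-ordered support, with the valuation $v$ sending a nonzero series to the least element of its support and $0$ to $+\infty$. Then, in every elementary extension $M$ of the valued field $K$, the subset $K$ is uniformly stably embedded. -/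

import Mathlib

open FirstOrder

universe u v w

namespace HahnStableEmbedding

/-- The only non-algebraic symbol of the one-sorted language of valued fields: a binary relation. -/
inductive DivRel : ℕ → Type
  | div : DivRel 2

/-- The language with a single binary relation symbol `div`. -/
def divLanguage : FirstOrder.Language.{0, 0} :=
  { Functions := fun _ => Empty
    Relations := DivRel }

/-- The one-sorted language of valued fields: the language of rings together with a binary
relation symbol `x div y`, to be read as `v x ≤ v y`. -/
abbrev valuedFieldLanguage : FirstOrder.Language.{0, 0} :=
  FirstOrder.Language.ring.sum divLanguage

section

variable {K Γ₀ : Type*} [Field K] [LinearOrderedAddCommMonoidWithTop Γ₀]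

/-- The interpretation of the symbol `div` in a valued field `(K, v)`. -/
@[reducible] def divStructure (v : AddValuation K Γ₀) : divLanguage.Structure K where
  funMap := fun f => Empty.elim f
  RelMap := fun {_} r =>
    match r with
    | DivRel.div => fun x => v (x 0) ≤ v (x 1)

/-- A valued field `(K, v)` as a structure in the one-sorted language of valued fields. -/
@[reducible] def valuedFieldStructure (v : AddValuation K Γ₀) :
    valuedFieldLanguage.Structure K :=
  letI := FirstOrder.Ring.compatibleRingOfRing K
  letI := divStructure v
  FirstOrder.Language.sumStructure FirstOrder.Language.ring divLanguage K

end

/-- The Hahn field `k((t^Γ))` (series with well-ordered support), with its `t`-adic valuation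
(the least element of the support; `⊤` at the zero series), as a structure in the one-sorted
language of valued fields. -/
noncomputable instance hahnFieldStructure (Γ k : Type*) [AddCommGroup Γ] [LinearOrder Γ]
    [IsOrderedAddMonoid Γ] [Field k] : valuedFieldLanguage.Structure (HahnSeries Γ k) :=
  valuedFieldStructure (HahnSeries.addVal Γ k)

/-- A subset `A` of an `L`-structure `M` is uniformly stably embedded if for every formula
`φ(x; t)` there is a formula `χ(x; s)` such that for every tuple `b` of `M` there is a tuple `a`
of `A` with `φ(A, b) = χ(A, a)`; both formulas are evaluated in `M`. -/
def UniformlyStablyEmbedded (L : FirstOrder.Language.{u, v}) {M : Type w} [L.Structure M]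
    (A : Set M) : Prop :=
  ∀ (m n : ℕ) (φ : L.Formula (Fin m ⊕ Fin n)),
    ∃ (l : ℕ) (χ : L.Formula (Fin m ⊕ Fin l)),
      ∀ b : Fin n → M, ∃ a : Fin l → M, (∀ i, a i ∈ A) ∧
        {x : Fin m → M | (∀ i, x i ∈ A) ∧ φ.Realize (Sum.elim x b)} =
          {x : Fin m → M | (∀ i, x i ∈ A) ∧ χ.Realize (Sum.elim x a)}

end HahnStableEmbedding

/-! Write `K` for the Hahn field and `M` for the extension. `K` is an algebraically closed field
with a nontrivial valuation; the models of its theory are again such fields, and these eliminate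
quantifiers (`exists_isQF_iff_of_isACVF`). So it suffices to treat one condition `v(s(x,b)) ≤
v(t(x,b))`, with `s`, `t` integer polynomials, `x` in `K` and `b` in `M`.

Separating variables, `s` and `t` are `K`-linear combinations of finitely many elements `q_j(b)` of
`M`, the coefficients being polynomials in `x`. Since `K` is spherically complete
(`ExtendsHahn.exists_mem_balls`), best approximations exist and a Gram–Schmidt process expresses the
`q_j(b)` through a valuation independent family `e` (`ExtendsHahn.exists_valuationIndependent`): the
value of a combination of the `e_i` is that of its dominant term. The condition thus becomes a
finite Boolean combination of conditions comparing `v(Y(x) e_i)` with `v(Z(x) e_j)`, where `Y`, `Z`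
are polynomials with parameters in `K`. For nonzero `Y(x)`, `Z(x)` and `e_i`, such a condition only
says that `v(Y(x)) - v(Z(x))` lies in a certain upward closed subset of `ℝ`. By completeness of `ℝ`
that subset is empty, everything, or a ray with an endpoint in `ℝ`, which an element of `K` names
(`ExtendsHahn.exists_cut`). The number of terms and the shape of the polynomials do not depend on
`b`, whence uniformity.

Quantifier elimination rests on amalgamating valued fields inside a quotient of a tensor product of
valuation rings, and on realizing finitely many valuation comparisons in one variable. Spherical
completeness also gives, in every characteristic, that `K` is algebraically closed: the best
approximation to an algebraic element can be improved unless it equals it. -/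

namespace HahnStableEmbedding

/-! ### Amalgamation of valued fields through tensor products of valuation rings. -/

section Amalgamation

open TensorProduct IsLocalRing

theorem exists_tensor_lift {R A B C : Type*} [CommRing R] [CommRing A] [CommRing B] [CommRing C]
    [Algebra R A] [Algebra R B] (f : A →+* C) (g : B →+* C)
    (h : f.comp (algebraMap R A) = g.comp (algebraMap R B)) :
    ∃ l : A ⊗[R] B →+* C, (∀ a, l (a ⊗ₜ 1) = f a) ∧ ∀ b, l (1 ⊗ₜ b) = g b := by
  let := (f.comp (algebraMap R A)).toAlgebra
  let f' : A →ₐ[R] C := { f with commutes' := fun r => rfl }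
  let g' : B →ₐ[R] C := { g with commutes' := fun r => (RingHom.congr_fun h r).symm }
  refine ⟨(Algebra.TensorProduct.productMap f' g').toRingHom, fun a => ?_, fun b => ?_⟩
  · exact Algebra.TensorProduct.productMap_left_apply f' g' a
  · exact Algebra.TensorProduct.productMap_right_apply f' g' b

/-- Going down for flat algebras: otherwise a prime over `⊥` would lie strictly inside the minimal
prime. -/
theorem comap_eq_bot_of_mem_minimalPrimes {A T : Type*} [CommRing A] [IsDomain A] [CommRing T]
    [Algebra A T] [Module.Flat A T] (q : Ideal T) (hq : q ∈ minimalPrimes T) :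
    q.comap (algebraMap A T) = ⊥ := by
  have : q.IsPrime := hq.1.1
  obtain ⟨Q, hQ, hQp, hQo⟩ := Ideal.exists_ideal_le_liesOver_of_le (p := (⊥ : Ideal A))
    (q := q.comap (algebraMap A T)) q bot_le
  have : q ≤ Q := hq.2 ⟨hQp, bot_le⟩ hQ
  obtain rfl := le_antisymm hQ this
  exact hQo.over.symm

theorem flat_of_valuationRing {R A : Type*} [CommRing R] [IsDomain R] [ValuationRing R]
    [CommRing A] [IsDomain A] [Algebra R A] (h : Function.Injective (algebraMap R A)) :
    Module.Flat R A := by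
  rw [Module.Flat.flat_iff_torsion_eq_bot_of_isBezout]
  have := (faithfulSMul_iff_algebraMap_injective R A).2 h
  exact Submodule.isTorsionFree_iff_torsion_eq_bot.1 inferInstance

/-- The tensor product of the residue fields over a field is nonzero; a maximal ideal of it is
pulled back. -/
theorem exists_prime_over_maximalIdeals {R A B : Type*} [CommRing R] [CommRing A] [CommRing B]
    [IsLocalRing R] [IsLocalRing A] [IsLocalRing B] [Algebra R A] [Algebra R B]
    [IsLocalHom (algebraMap R A)] [IsLocalHom (algebraMap R B)] :
    ∃ P : Ideal (A ⊗[R] B), P.IsPrime ∧ (∀ a ∈ maximalIdeal A, a ⊗ₜ 1 ∈ P) ∧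
      (∀ b ∈ maximalIdeal B, 1 ⊗ₜ b ∈ P) := by
  let C := ResidueField A ⊗[ResidueField R] ResidueField B
  let f : A →+* C := (Algebra.TensorProduct.includeLeft (R := ResidueField R)
    (S := ResidueField R)).toRingHom.comp (residue A)
  let g : B →+* C := (Algebra.TensorProduct.includeRight (R := ResidueField R)
    (A := ResidueField A) (B := ResidueField B)).toRingHom.comp (residue B)
  have h : f.comp (algebraMap R A) = g.comp (algebraMap R B) := by
    ext r
    have h1 := (Algebra.TensorProduct.includeLeft (R := ResidueField R) (S := ResidueField R)
      (A := ResidueField A) (B := ResidueField B)).commutes (residue R r)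
    have h2 := (Algebra.TensorProduct.includeRight (R := ResidueField R)
      (A := ResidueField A) (B := ResidueField B)).commutes (residue R r)
    exact h1.trans h2.symm
  obtain ⟨l, hl1, hl2⟩ := exists_tensor_lift f g h
  obtain ⟨m, hm⟩ := Ideal.exists_maximal C
  refine ⟨m.comap l, hm.isPrime.comap l, fun a ha => ?_, fun b hb => ?_⟩
  · have : f a = 0 := by
      simp [f, (residue_eq_zero_iff a).2 ha]
    simp [Ideal.mem_comap, hl1, this]
  · have : g b = 0 := by
      simp [g, (residue_eq_zero_iff b).2 hb]
    simp [Ideal.mem_comap, hl2, this]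

/-- Valuation rings are maximal for domination: if `x ∉ A` then `x⁻¹` is a nonunit of `A`, which
keeps `i x` out of `O`. -/
theorem comap_eq_of_dominates {M Ω : Type*} [Field M] [Field Ω] (A : ValuationSubring M)
    (O : ValuationSubring Ω) (i : M →+* Ω) (h1 : ∀ a ∈ A, i a ∈ O)
    (h2 : ∀ a ∈ A.nonunits, i a ∈ O.nonunits) : O.comap i = A := by
  ext x
  rw [ValuationSubring.mem_comap]
  refine ⟨fun hx => ?_, h1 x⟩
  by_contra hxA
  have hx0 : x ≠ 0 := by rintro rfl; exact hxA A.zero_mem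
  have : x⁻¹ ∈ A.nonunits := by
    rw [ValuationSubring.mem_nonunits_iff, map_inv₀]
    rw [← A.valuation_le_one_iff, not_le] at hxA
    exact inv_lt_one_of_one_lt₀ hxA
  have := h2 _ this
  rw [ValuationSubring.mem_nonunits_iff, map_inv₀, map_inv₀] at this
  rw [← O.valuation_le_one_iff] at hx
  have h0 : O.valuation (i x) ≠ 0 := by simpa using hx0
  have := (one_le_inv₀ (zero_lt_iff.2 h0)).2 hx
  order

theorem isLocalHom_of_comap {F M : Type*} [Field F] [Field M] (i : F →+* M)
    (A : ValuationSubring M) (R : ValuationSubring F) (h : A.comap i = R) (f : R →+* A)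
    (hf : ∀ x, (f x : M) = i x) : IsLocalHom f := by
  refine ⟨fun x hx => ?_⟩
  obtain ⟨y, hy⟩ := hx.exists_right_inv
  have hy' : i x * y = 1 := by rw [← hf]; exact congrArg Subtype.val hy
  have h1 : (x : F)⁻¹ ∈ R := by
    have : i (x : F)⁻¹ ∈ A := by
      rw [map_inv₀, ← eq_inv_of_mul_eq_one_right hy']
      exact y.2
    exact (congrArg ((x : F)⁻¹ ∈ ·) h).mp this
  refine IsUnit.of_mul_eq_one ⟨_, h1⟩ (Subtype.ext (mul_inv_cancel₀ (a := (x : F)) fun h0 => ?_))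
  rw [h0, map_zero, zero_mul] at hy'
  exact zero_ne_one hy'

/-- Two primes `q ≤ P` of `T` share the work. Being minimal, `q` meets `A` and `B` trivially by
flatness, so both embed in the fraction field of `T ⧸ q`. The image of `P` stays proper, and a
valuation ring having it among its nonunits dominates both `A` and `B`. -/
theorem exists_valued_field_of_flat {T : Type u} [CommRing T] {M N : Type u} [Field M] [Field N]
    (A : ValuationSubring M) (B : ValuationSubring N) [Algebra A T] [Algebra B T]
    [Module.Flat A T] [Module.Flat B T] (P : Ideal T) [hP : P.IsPrime]
    (hPA : ∀ a ∈ maximalIdeal A, algebraMap A T a ∈ P)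
    (hPB : ∀ b ∈ maximalIdeal B, algebraMap B T b ∈ P) :
    ∃ (Ω : Type u) (_ : Field Ω) (O : ValuationSubring Ω) (π : T →+* Ω) (i : M →+* Ω) (j : N →+* Ω),
      (∀ a : A, i a = π (algebraMap A T a)) ∧ (∀ b : B, j b = π (algebraMap B T b)) ∧
      O.comap i = A ∧ O.comap j = B := by
  obtain ⟨q, hq, hqP⟩ := Ideal.exists_minimalPrimes_le (I := (⊥ : Ideal T)) (J := P) bot_le
  have : q.IsPrime := hq.1.1
  have hqA := comap_eq_bot_of_mem_minimalPrimes (A := A) q hq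
  have hqB := comap_eq_bot_of_mem_minimalPrimes (A := B) q hq
  let Ω := FractionRing (T ⧸ q)
  let π : T →+* Ω := (algebraMap _ Ω).comp (Ideal.Quotient.mk q)
  have hπ : ∀ x, π x = 0 ↔ x ∈ q := fun x => by
    rw [← Ideal.Quotient.eq_zero_iff_mem]
    exact (map_eq_zero_iff _ (IsFractionRing.injective (T ⧸ q) Ω))
  let I : Ideal π.range := P.map π.rangeRestrict
  have hI : I ≠ ⊤ := by
    intro hI
    have h1 : I.comap π.rangeRestrict = P := by
      rw [Ideal.comap_map_of_surjective _ π.rangeRestrict_surjective]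
      refine sup_eq_left.2 fun x hx => hqP ((hπ x).1 ?_)
      exact congrArg Subtype.val ((Ideal.mem_bot).1 (Ideal.mem_comap.1 hx))
    rw [hI, Ideal.comap_top] at h1
    exact hP.ne_top h1.symm
  obtain ⟨O, hO, hIu⟩ := Ideal.image_subset_nonunits_valuationSubring I hI
  have hmem : ∀ x, π x ∈ O := fun x => hO ⟨x, rfl⟩
  have hnon : ∀ x ∈ P, π x ∈ O.nonunits := fun x hx =>
    hIu ⟨π.rangeRestrict x, Ideal.mem_map_of_mem _ hx, rfl⟩
  let f' : A →+* Ω := π.comp (algebraMap A T)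
  let g' : B →+* Ω := π.comp (algebraMap B T)
  have hf' : Function.Injective f' := by
    rw [injective_iff_map_eq_zero]
    intro a ha
    have : a ∈ q.comap (algebraMap A T) := (hπ _).1 ha
    rwa [hqA] at this
  have hg' : Function.Injective g' := by
    rw [injective_iff_map_eq_zero]
    intro b hb
    have : b ∈ q.comap (algebraMap B T) := (hπ _).1 hb
    rwa [hqB] at this
  have hli : ∀ a : A, IsFractionRing.lift (K := M) hf' a = f' a :=
    fun a => IsFractionRing.lift_algebraMap hf' a
  have hlj : ∀ b : B, IsFractionRing.lift (K := N) hg' b = g' b :=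
    fun b => IsFractionRing.lift_algebraMap hg' b
  refine ⟨Ω, inferInstance, O, π, IsFractionRing.lift hf', IsFractionRing.lift hg', hli, hlj,
    ?_, ?_⟩
  · refine comap_eq_of_dominates A O _ (fun a ha => ?_) fun a ha => ?_
    · rw [hli ⟨a, ha⟩]; exact hmem _
    · obtain ⟨ha', ha⟩ := ValuationSubring.mem_nonunits_iff_exists_mem_maximalIdeal.1 ha
      rw [hli ⟨a, ha'⟩]; exact hnon _ (hPA _ ha)
  · refine comap_eq_of_dominates B O _ (fun a ha => ?_) fun a ha => ?_
    · rw [hlj ⟨a, ha⟩]; exact hmem _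
    · obtain ⟨ha', ha⟩ := ValuationSubring.mem_nonunits_iff_exists_mem_maximalIdeal.1 ha
      rw [hlj ⟨a, ha'⟩]; exact hnon _ (hPB _ ha)

/-- Torsion-free modules over the valuation ring `R` of `F` are flat, so `A ⊗[R] B` is flat over
each factor and `exists_valued_field_of_flat` applies. -/
theorem exists_valued_amalgam {F M N : Type u} [Field F] [Field M] [Field N] (i : F →+* M)
    (j : F →+* N) (A : ValuationSubring M) (B : ValuationSubring N) (h : A.comap i = B.comap j) :
    ∃ (Ω : Type u) (_ : Field Ω) (O : ValuationSubring Ω) (i' : M →+* Ω) (j' : N →+* Ω),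
      i'.comp i = j'.comp j ∧ O.comap i' = A ∧ O.comap j' = B := by
  obtain ⟨R, hR⟩ : ∃ R, R = A.comap i := ⟨_, rfl⟩
  have hA : ∀ x : R, i x ∈ A := fun x => by
    rw [← ValuationSubring.mem_comap, ← hR]; exact x.2
  have hB : ∀ x : R, j x ∈ B := fun x => by
    rw [← ValuationSubring.mem_comap, ← h, ← hR]; exact x.2
  let f : R →+* A := (i.comp R.subtype).codRestrict A hA
  let g : R →+* B := (j.comp R.subtype).codRestrict B hB
  let := f.toAlgebra
  let := g.toAlgebra
  have hf : Function.Injective (algebraMap R A) := fun x y hxy =>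
    Subtype.ext (i.injective (congrArg Subtype.val hxy))
  have hg : Function.Injective (algebraMap R B) := fun x y hxy =>
    Subtype.ext (j.injective (congrArg Subtype.val hxy))
  have := flat_of_valuationRing hf
  have := flat_of_valuationRing hg
  have : IsLocalHom (algebraMap R A) := isLocalHom_of_comap i A R hR.symm f fun _ => rfl
  have : IsLocalHom (algebraMap R B) := isLocalHom_of_comap j B R (h ▸ hR.symm) g fun _ => rfl
  obtain ⟨P, hP, hPA, hPB⟩ := exists_prime_over_maximalIdeals (R := R) (A := A) (B := B)
  let : Algebra B (A ⊗[R] B) := Algebra.TensorProduct.rightAlgebra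
  let e : A ⊗[R] B ≃ₐ[B] B ⊗[R] A :=
    { __ := Algebra.TensorProduct.comm _ _ _, commutes' _ := rfl }
  have : Module.Flat B (A ⊗[R] B) := Module.Flat.of_linearEquiv e.toLinearEquiv
  obtain ⟨Ω, hΩ, O, π, i', j', hi, hj, hi', hj'⟩ := exists_valued_field_of_flat A B P hPA hPB
  refine ⟨Ω, hΩ, O, i', j', ?_, hi', hj'⟩
  refine IsLocalization.ringHom_ext (nonZeroDivisors R) (RingHom.ext fun r => ?_)
  refine (hi (f r)).trans (Eq.trans (congrArg π ?_) (hj (g r)).symm)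
  exact (Algebra.TensorProduct.algebraMap_apply (S := R) (A := A) (B := B) r).symm.trans
    (Algebra.TensorProduct.algebraMap_apply' r)

end Amalgamation

/-! ### Valuation comparisons in one variable over an algebraically closed field. -/

section ValuedField

variable {N Γ₀ : Type*} [Field N] [LinearOrderedCommGroupWithZero Γ₀] (v : Valuation N Γ₀)

theorem valuation_sub_eq_max_of_le {u d : N} (h : v u ≤ v (u - d)) :
    v (u - d) = max (v u) (v d) := by
  refine le_antisymm (v.map_sub u d) (max_le h ?_)
  have := v.map_sub u (u - d)
  rw [sub_sub_cancel, max_eq_right h] at this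
  exact this

theorem eq_one_of_prod_eq_one {ι : Type*} (s : Finset ι) (f : ι → Γ₀) (hf : ∀ i ∈ s, f i ≤ 1)
    (h : ∏ i ∈ s, f i = 1) : ∀ i ∈ s, f i = 1 := by
  classical
  intro i hi
  refine le_antisymm (hf i hi) ?_
  rw [← Finset.mul_prod_erase s f hi] at h
  have : ∏ x ∈ s.erase i, f x ≤ 1 := Finset.prod_le_one' fun x hx =>
    hf x (Finset.mem_of_mem_erase hx)
  calc (1 : Γ₀) = f i * ∏ x ∈ s.erase i, f x := h.symm
    _ ≤ f i * 1 := mul_le_mul_right this _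
    _ = f i := mul_one _

theorem exists_unit_avoiding [IsAlgClosed N] (s : Finset N) (hs : ∀ d ∈ s, v d ≤ 1) :
    ∃ t, v t = 1 ∧ ∀ d ∈ s, v (t - d) = 1 := by
  classical
  -- A root of `1 + ∏ (X - d)` makes the values `v (t - d)` multiply to 1 while each is at most 1,
  -- so each equals 1. Including `d = 0` gives `v t = 1` and a positive degree.
  obtain ⟨t, ht⟩ := IsAlgClosed.exists_root
    (Polynomial.C 1 + ∏ d ∈ insert 0 s, (Polynomial.X - Polynomial.C d)) (by
      have h : (0 : WithBot ℕ) < (∏ d ∈ insert 0 s, (Polynomial.X - Polynomial.C d)).degree := by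
        rw [Polynomial.degree_prod]
        simp only [Polynomial.degree_X_sub_C, Finset.sum_const, nsmul_eq_mul, mul_one]
        exact_mod_cast Finset.card_pos.2 ⟨0, Finset.mem_insert_self _ _⟩
      rw [Polynomial.degree_add_eq_right_of_degree_lt (Polynomial.degree_C_le.trans_lt h)]
      exact h.ne')
  have h1 : ∏ d ∈ insert 0 s, v (t - d) = 1 := by
    rw [Polynomial.IsRoot, Polynomial.eval_add, Polynomial.eval_prod, add_comm] at ht
    simp only [Polynomial.eval_sub, Polynomial.eval_X, Polynomial.eval_C] at ht
    rw [← map_prod, eq_neg_of_add_eq_zero_left ht, Valuation.map_neg, map_one]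
  have hs' : ∀ d ∈ insert 0 s, v d ≤ 1 := by simpa using hs
  have htle : v t ≤ 1 := by
    by_contra! hlt
    have : ∀ d ∈ insert 0 s, v (t - d) = v t := fun d hd =>
      v.map_sub_eq_of_lt_left ((hs' d hd).trans_lt hlt)
    rw [Finset.prod_congr rfl this, Finset.prod_const] at h1
    exact (one_lt_pow₀ hlt (Finset.card_ne_zero_of_mem (Finset.mem_insert_self 0 s))).ne' h1
  have := eq_one_of_prod_eq_one _ _ (fun d hd => (v.map_sub t d).trans (max_le htle (hs' d hd))) h1
  exact ⟨t, by simpa using this 0 (Finset.mem_insert_self _ _),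
    fun d hd => this d (Finset.mem_insert_of_mem hd)⟩

theorem exists_generic [IsAlgClosed N] (s : Finset N) {z : N} (hz : z ≠ 0) :
    ∃ w, v w = v z ∧ ∀ d ∈ s, v (w - d) = max (v w) (v d) := by
  classical
  have hvz : v z ≠ 0 := by simpa using hz
  obtain ⟨t, ht, hts⟩ := exists_unit_avoiding v ((s.filter (v · ≤ v z)).image (· / z)) (by
    simp only [Finset.mem_image, Finset.mem_filter]
    rintro _ ⟨d, ⟨-, hd⟩, rfl⟩
    rw [map_div₀]
    exact div_le_one_of_le₀ hd zero_le)
  have hw : v (t * z) = v z := by rw [map_mul, ht, one_mul]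
  refine ⟨t * z, hw, fun d hd => ?_⟩
  rw [hw]
  rcases le_or_gt (v d) (v z) with h | h
  · have h1 := hts (d / z) (Finset.mem_image_of_mem _ (Finset.mem_filter.2 ⟨hd, h⟩))
    have h2 : t * z - d = (t - d / z) * z := by field_simp
    rw [h2, map_mul, h1, one_mul, max_eq_left h]
  · rw [max_eq_right h.le, v.map_sub_eq_of_lt_right (hw.symm ▸ h)]

/-- A square root of `x * y` has a value strictly between; when `x = 0`, shrink `y` by an element of
value less than 1. -/
theorem exists_between_valuation [IsAlgClosed N] (hv : ∃ x, x ≠ 0 ∧ v x < 1) {x y : N}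
    (h : v x < v y) : ∃ z, v x < v z ∧ v z < v y := by
  have hy : 0 < v y := lt_of_le_of_lt zero_le h
  rcases eq_or_ne x 0 with rfl | hx
  · obtain ⟨p, hp0, hp⟩ := hv
    refine ⟨p * y, ?_, ?_⟩
    · rw [map_zero, map_mul]
      exact mul_pos (zero_lt_iff.2 (by simpa using hp0)) hy
    · rw [map_mul]
      exact mul_lt_of_lt_one_left hy hp
  · have hx0 : 0 < v x := zero_lt_iff.2 (by simpa using hx)
    obtain ⟨z, hz⟩ := IsAlgClosed.exists_pow_nat_eq (x * y) (n := 2) two_pos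
    have hz' : v z ^ 2 = v x * v y := by rw [← map_pow, hz, map_mul]
    refine ⟨z, lt_of_pow_lt_pow_left₀ 2 zero_le ?_, lt_of_pow_lt_pow_left₀ 2 zero_le ?_⟩
    · rw [hz', sq]; exact mul_lt_mul_of_pos_left h hx0
    · rw [hz', sq]; exact mul_lt_mul_of_pos_right h hy

theorem exists_valuation_gt (hv : ∃ x, x ≠ 0 ∧ v x < 1) (x : N) : ∃ z, v x < v z := by
  obtain ⟨p, hp0, hp⟩ := hv
  rcases eq_or_ne x 0 with rfl | hx
  · exact ⟨1, by simp⟩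
  · have hx0 : 0 < v x := zero_lt_iff.2 (by simpa using hx)
    refine ⟨x / p, ?_⟩
    rw [map_div₀]
    exact (lt_div_iff₀ (zero_lt_iff.2 (by simpa using hp0))).2 (mul_lt_of_lt_one_right hx0 hp)

theorem exists_same_cut [IsAlgClosed N] (hv : ∃ x, x ≠ 0 ∧ v x < 1) (s : Finset N) {γ : Γ₀}
    (hγ : γ ≠ 0) : ∃ z, z ≠ 0 ∧ ∀ d ∈ s, (v d ≤ γ ↔ v d ≤ v z) ∧ (γ ≤ v d ↔ v z ≤ v d) := by
  classical
  by_cases hex : ∃ d ∈ s, v d = γ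
  · obtain ⟨d, -, rfl⟩ := hex
    exact ⟨d, by simpa using hγ, fun _ _ => ⟨Iff.rfl, Iff.rfl⟩⟩
  have hne : ∀ d ∈ s, v d < γ ∨ γ < v d := fun d hd => lt_or_gt_of_ne fun h => hex ⟨d, hd, h⟩
  obtain ⟨a, ha, hamax⟩ := Finset.exists_max_image (insert 0 (s.filter (v · < γ))) v
    ⟨0, Finset.mem_insert_self _ _⟩
  have haγ : v a < γ := by
    rcases Finset.mem_insert.1 ha with rfl | ha
    · simpa using zero_lt_iff.2 hγ
    · exact (Finset.mem_filter.1 ha).2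
  suffices ∃ z, v a < v z ∧ ∀ d ∈ s, γ < v d → v z < v d by
    obtain ⟨z, haz, hz⟩ := this
    refine ⟨z, fun h => ?_, fun d hd => ?_⟩
    · simp [h] at haz
    rcases hne d hd with h | h
    · have : v d < v z :=
        (hamax d (Finset.mem_insert_of_mem (Finset.mem_filter.2 ⟨hd, h⟩))).trans_lt haz
      exact ⟨iff_of_true h.le this.le, iff_of_false h.not_ge this.not_ge⟩
    · have := hz d hd h
      exact ⟨iff_of_false h.not_ge this.not_ge, iff_of_true h.le this.le⟩
  rcases (s.filter (γ < v ·)).eq_empty_or_nonempty with he | he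
  · obtain ⟨z, hz⟩ := exists_valuation_gt v hv a
    exact ⟨z, hz, fun d hd hd' =>
      absurd (he ▸ Finset.mem_filter.2 ⟨hd, hd'⟩) (Finset.notMem_empty d)⟩
  · obtain ⟨b, hb, hbmin⟩ := Finset.exists_min_image _ v he
    obtain ⟨z, hz1, hz2⟩ := exists_between_valuation v hv (haγ.trans (Finset.mem_filter.1 hb).2)
    exact ⟨z, hz1, fun d hd hd' => hz2.trans_le (hbmin d (Finset.mem_filter.2 ⟨hd, hd'⟩))⟩

/-- Two monomials in `γ` exchange their order at most once, at the value of a root of `e / e'` or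
`e' / e` of order the difference of the exponents. The cut of `γ` at that value decides the
comparison. -/
theorem exists_break_point [IsAlgClosed N] (e e' : N) (m m' : ℕ) :
    ∃ h : N, ∀ γ γ' : Γ₀, γ ≠ 0 → γ' ≠ 0 → (v h ≤ γ ↔ v h ≤ γ') → (γ ≤ v h ↔ γ' ≤ v h) →
      (v e * γ ^ m ≤ v e' * γ ^ m' ↔ v e * γ' ^ m ≤ v e' * γ' ^ m') := by
  rcases eq_or_ne e 0 with rfl | he
  · exact ⟨0, by simp⟩
  rcases eq_or_ne e' 0 with rfl | he'
  · exact ⟨0, by simp +contextual⟩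
  have hve : 0 < v e := zero_lt_iff.2 (by simpa using he)
  have hve' : 0 < v e' := zero_lt_iff.2 (by simpa using he')
  rcases le_or_gt m m' with hm | hm
  · obtain ⟨k, rfl⟩ := Nat.exists_eq_add_of_le hm
    have key : ∀ γ : Γ₀, γ ≠ 0 → (v e * γ ^ m ≤ v e' * γ ^ (m + k) ↔ v (e / e') ≤ γ ^ k) := by
      intro γ hγ
      rw [add_comm m, pow_add, ← mul_assoc, mul_le_mul_iff_left₀ (pow_pos (zero_lt_iff.2 hγ) m),
        map_div₀, div_le_iff₀' hve']
    rcases Nat.eq_zero_or_pos k with rfl | hk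
    · exact ⟨0, fun γ γ' h h' _ _ => by rw [key γ h, key γ' h', pow_zero, pow_zero]⟩
    obtain ⟨h, hh⟩ := IsAlgClosed.exists_pow_nat_eq (e / e') hk
    refine ⟨h, fun γ γ' h0 h0' h1 _ => ?_⟩
    rw [key γ h0, key γ' h0', ← hh, map_pow, pow_le_pow_iff_left₀ zero_le zero_le hk.ne',
      pow_le_pow_iff_left₀ zero_le zero_le hk.ne', h1]
  · obtain ⟨k, rfl⟩ := Nat.exists_eq_add_of_le hm.le
    have hk : k ≠ 0 := by omega
    have key : ∀ γ : Γ₀, γ ≠ 0 → (v e * γ ^ (m' + k) ≤ v e' * γ ^ m' ↔ γ ^ k ≤ v (e' / e)) := by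
      intro γ hγ
      rw [add_comm m', pow_add, ← mul_assoc, mul_le_mul_iff_left₀ (pow_pos (zero_lt_iff.2 hγ) m'),
        map_div₀, le_div_iff₀' hve]
    obtain ⟨h, hh⟩ := IsAlgClosed.exists_pow_nat_eq (e' / e) (Nat.pos_of_ne_zero hk)
    refine ⟨h, fun γ γ' h0 h0' _ h1 => ?_⟩
    rw [key γ h0, key γ' h0', ← hh, map_pow, pow_le_pow_iff_left₀ zero_le zero_le hk,
      pow_le_pow_iff_left₀ zero_le zero_le hk, h1]

theorem multiset_prod_max (s : Multiset N) (γ : Γ₀) :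
    (s.map fun d => max γ (v d)).prod =
      v (s.filter (γ < v ·)).prod * γ ^ (s.filter (v · ≤ γ)).card := by
  induction s using Multiset.induction_on with
  | empty => simp
  | cons d s ih =>
    rw [Multiset.map_cons, Multiset.prod_cons, ih]
    rcases le_or_gt (v d) γ with h | h
    · rw [max_eq_left h, Multiset.filter_cons_of_neg (p := (γ < v ·)) _ h.not_gt,
        Multiset.filter_cons_of_pos (p := (v · ≤ γ)) _ h,
        Multiset.card_cons, pow_succ']
      ac_rfl
    · rw [max_eq_right h.le, Multiset.filter_cons_of_pos (p := (γ < v ·)) _ h,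
        Multiset.filter_cons_of_neg (p := (v · ≤ γ)) _ h.not_ge,
        Multiset.prod_cons, map_mul, mul_assoc]

/-- If `u` is generic with respect to the shifted roots, the value of `P` at `a₀ + u` is a monomial
in `v u`: roots farther from `a₀` than `v u` go into the coefficient, the others into the exponent.
-/
theorem valuation_eval₂_eq {A : Type*} [Field A] [IsAlgClosed A] (φ : A →+* N)
    (w : Valuation A Γ₀) (hw : ∀ x, v (φ x) = w x) (P : Polynomial A) (a₀ : A) (u : N)
    (hu : ∀ a ∈ P.roots, v (u - φ (a - a₀)) = max (v u) (w (a - a₀))) :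
    v (P.eval₂ φ (φ a₀ + u)) =
      w (P.leadingCoeff * ((P.roots.map (· - a₀)).filter (v u < w ·)).prod) *
        v u ^ ((P.roots.map (· - a₀)).filter (w · ≤ v u)).card := by
  have h1 : P.eval₂ φ (φ a₀ + u) =
      φ P.leadingCoeff * (P.roots.map fun a => u - φ (a - a₀)).prod := by
    conv_lhs => rw [(IsAlgClosed.splits P).eq_prod_roots]
    rw [Polynomial.eval₂_mul, Polynomial.eval₂_C, ← Polynomial.coe_eval₂RingHom,
      map_multiset_prod, Multiset.map_map]
    refine congrArg (_ * Multiset.prod ·) (Multiset.map_congr rfl fun a _ => ?_)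
    simp only [Function.comp, Polynomial.coe_eval₂RingHom,
      Polynomial.eval₂_X, Polynomial.eval₂_C, map_sub]
    ring
  rw [h1, map_mul, hw, map_multiset_prod, Multiset.map_map, map_mul, mul_assoc,
    ← multiset_prod_max, Multiset.map_map]
  exact congrArg (_ * Multiset.prod ·) (Multiset.map_congr rfl hu)

/-- Centred at the root nearest to `y`, each polynomial of `s` has the value of a monomial in `v u`.
Only the position of `v u` among finitely many values from `A` matters, and `N` contains a generic
element in that position. -/
theorem exists_same_comparisons {A Ω : Type*} [Field A] [IsAlgClosed A] [Field Ω]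
    [IsAlgClosed N] (v : Valuation Ω Γ₀) (α : A →+* N) (j : N →+* Ω)
    (hv : ∃ x : N, x ≠ 0 ∧ v (j x) < 1) (s : Finset (Polynomial A)) (y : Ω) :
    ∃ y' : N, ∀ P ∈ s, ∀ Q ∈ s,
      (v (P.eval₂ (j.comp α) y) ≤ v (Q.eval₂ (j.comp α) y) ↔
        v (j (P.eval₂ α y')) ≤ v (j (Q.eval₂ α y'))) := by
  classical
  let S : Finset A := insert 0 (s.biUnion fun P => P.roots.toFinset)
  have hroots : ∀ P ∈ s, ∀ a ∈ P.roots, a ∈ S := fun P hP a ha =>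
    Finset.mem_insert_of_mem (Finset.mem_biUnion.2 ⟨P, hP, Multiset.mem_toFinset.2 ha⟩)
  obtain ⟨a₀, -, hmin⟩ := Finset.exists_min_image S (fun a => v (y - j (α a)))
    ⟨0, Finset.mem_insert_self _ _⟩
  obtain ⟨u, hu⟩ : ∃ u, u = y - j (α a₀) := ⟨_, rfl⟩
  have hy : y = j.comp α a₀ + u := by rw [hu, RingHom.comp_apply]; ring
  rcases eq_or_ne u 0 with h0 | h0
  · refine ⟨α a₀, fun P _ Q _ => ?_⟩
    rw [hy, h0, add_zero, Polynomial.eval₂_at_apply, Polynomial.eval₂_at_apply,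
      Polynomial.eval₂_at_apply, Polynomial.eval₂_at_apply, RingHom.comp_apply, RingHom.comp_apply]
  have hvu : v u ≠ 0 := by simpa using h0
  let w : Valuation A Γ₀ := v.comap (j.comp α)
  have humax : ∀ a ∈ S, v (u - j.comp α (a - a₀)) = max (v u) (w (a - a₀)) := by
    intro a ha
    refine valuation_sub_eq_max_of_le v ?_
    have h1 : u - j.comp α (a - a₀) = y - j (α a) := by
      rw [hu, RingHom.comp_apply, map_sub, map_sub]; ring
    rw [h1, hu]
    exact hmin a ha
  let e : Polynomial A → A := fun P =>
    P.leadingCoeff * ((P.roots.map (· - a₀)).filter (v u < w ·)).prod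
  let m : Polynomial A → ℕ := fun P => ((P.roots.map (· - a₀)).filter (w · ≤ v u)).card
  choose b hb using fun P Q => exists_break_point w (e P) (e Q) (m P) (m Q)
  -- The shifted roots fix which monomial each polynomial becomes; the break points fix the order of
  -- the monomials.
  let D : Finset A := S.image (· - a₀) ∪ (s ×ˢ s).image fun p => b p.1 p.2
  obtain ⟨z₀, hz₀, hcut⟩ := exists_same_cut (v.comap j) hv (D.image α) hvu
  obtain ⟨z, hz, hgen⟩ := exists_generic (v.comap j) (D.image α) hz₀
  rw [← hz] at hcut
  have hcut' : ∀ d ∈ D, (w d ≤ v u ↔ w d ≤ v (j z)) ∧ (v u ≤ w d ↔ v (j z) ≤ w d) :=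
    fun d hd => hcut _ (Finset.mem_image_of_mem _ hd)
  have hzu : v (j z) ≠ 0 := by
    have : (v.comap j) z ≠ 0 := by rw [hz]; simpa using hz₀
    exact this
  have hSD : ∀ P ∈ s, ∀ d ∈ P.roots.map (· - a₀), d ∈ D := by
    intro P hP d hd
    obtain ⟨a, ha, rfl⟩ := Multiset.mem_map.1 hd
    exact Finset.mem_union_left _ (Finset.mem_image_of_mem _ (hroots P hP a ha))
  have hyeval : ∀ P ∈ s, v (P.eval₂ (j.comp α) y) = w (e P) * v u ^ m P := by
    intro P hP
    rw [hy]
    exact valuation_eval₂_eq v (j.comp α) w (fun _ => rfl) P a₀ u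
      fun a ha => humax a (hroots P hP a ha)
  have hzeval : ∀ P ∈ s, v (j (P.eval₂ α (α a₀ + z))) = w (e P) * v (j z) ^ m P := by
    intro P hP
    have h1 := valuation_eval₂_eq (v.comap j) α w (fun _ => rfl) P a₀ z fun a ha =>
      hgen _ (Finset.mem_image_of_mem _ (hSD P hP _ (Multiset.mem_map_of_mem _ ha)))
    have h2 : (P.roots.map (· - a₀)).filter (v u < w ·) =
        (P.roots.map (· - a₀)).filter ((v.comap j) z < w ·) :=
      Multiset.filter_congr fun d hd => by
        rw [← not_le, ← not_le]
        exact not_congr (hcut' d (hSD P hP d hd)).1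
    have h3 : (P.roots.map (· - a₀)).filter (w · ≤ v u) =
        (P.roots.map (· - a₀)).filter (w · ≤ (v.comap j) z) :=
      Multiset.filter_congr fun d hd => (hcut' d (hSD P hP d hd)).1
    simp only [e, m, h2, h3]
    exact h1
  refine ⟨α a₀ + z, fun P hP Q hQ => ?_⟩
  have hbD : b P Q ∈ D := Finset.mem_union_right _
    (Finset.mem_image.2 ⟨(P, Q), Finset.mem_product.2 ⟨hP, hQ⟩, rfl⟩)
  rw [hyeval P hP, hyeval Q hQ, hzeval P hP, hzeval Q hQ]
  exact hb P Q _ _ hvu hzu (hcut' _ hbD).1 (hcut' _ hbD).2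

end ValuedField

/-! ### Transferring a point between valued fields with the same comparisons. -/

theorem valuation_le_iff_of_comap_eq {M Ω : Type*} [Field M] [Field Ω] (O : ValuationSubring Ω)
    (A : ValuationSubring M) (i : M →+* Ω) (h : O.comap i = A) (x y : M) :
    O.valuation (i x) ≤ O.valuation (i y) ↔ A.valuation x ≤ A.valuation y := by
  rcases eq_or_ne y 0 with rfl | hy
  · simp
  have h1 : 0 < O.valuation (i y) := zero_lt_iff.2 (by simpa using hy)
  have h2 : 0 < A.valuation y := zero_lt_iff.2 (by simpa using hy)
  rw [← div_le_one₀ h1, ← div_le_one₀ h2, ← map_div₀, ← map_div₀, ← map_div₀,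
    ValuationSubring.valuation_le_one_iff, ValuationSubring.valuation_le_one_iff, ← h,
    ValuationSubring.mem_comap]

/-- Comparing with 0 shows that `f` and `g` have the same kernel, so the fraction field of the image
of `f` embeds in both fields with the same induced valuation ring, and amalgamation applies. -/
theorem exists_valued_amalgam_of_same_comparisons {R : Type*} {M N : Type u} [CommRing R] [Field M]
    [Field N] (A : ValuationSubring M) (B : ValuationSubring N) (f : R →+* M) (g : R →+* N)
    (h : ∀ p q, A.valuation (f p) ≤ A.valuation (f q) ↔ B.valuation (g p) ≤ B.valuation (g q)) :
    ∃ (Ω : Type u) (_ : Field Ω) (O : ValuationSubring Ω) (i : M →+* Ω) (j : N →+* Ω),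
      (∀ r, i (f r) = j (g r)) ∧ O.comap i = A ∧ O.comap j = B := by
  have h0 : ∀ r, f r = 0 ↔ g r = 0 := fun r => by simpa using h r 0
  have hker : ∀ p q, f p = f q → g p = g q := fun p q hpq => by
    rw [← sub_eq_zero, ← map_sub, ← h0, map_sub, hpq, sub_self]
  let D := f.range
  let s : D → R := fun d => d.2.choose
  have hs : ∀ d, f (s d) = d := fun d => d.2.choose_spec
  let g' : D →+* N :=
    { toFun := fun d => g (s d)
      map_one' := (hker _ 1 (by rw [hs, map_one]; rfl)).trans (map_one g)
      map_zero' := (hker _ 0 (by rw [hs, map_zero]; rfl)).trans (map_zero g)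
      map_mul' := fun x y => (hker _ (s x * s y) (by simp [hs])).trans (map_mul g _ _)
      map_add' := fun x y => (hker _ (s x + s y) (by simp [hs])).trans (map_add g _ _) }
  have hg' : Function.Injective g' := by
    rw [injective_iff_map_eq_zero]
    exact fun d hd => Subtype.ext ((hs d).symm.trans ((h0 _).2 hd))
  have hD : Function.Injective D.subtype := Subtype.val_injective
  let F := FractionRing D
  let i₀ : F →+* M := IsFractionRing.lift hD
  let j₀ : F →+* N := IsFractionRing.lift hg'
  have hi₀ : ∀ d : D, i₀ (algebraMap D F d) = f (s d) := fun d =>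
    (IsFractionRing.lift_algebraMap hD d).trans (hs d).symm
  have hj₀ : ∀ d : D, j₀ (algebraMap D F d) = g (s d) := fun d =>
    IsFractionRing.lift_algebraMap hg' d
  have hcomap : A.comap i₀ = B.comap j₀ := by
    ext x
    obtain ⟨p, q, hq, rfl⟩ := IsFractionRing.div_surjective (A := D) x
    have hq0 : f (s q) ≠ 0 := by
      rw [hs]
      exact fun h => nonZeroDivisors.ne_zero hq (Subtype.ext h)
    have hq0' : g (s q) ≠ 0 := fun h => hq0 ((h0 _).2 h)
    rw [ValuationSubring.mem_comap, ValuationSubring.mem_comap, map_div₀, map_div₀, hi₀, hi₀, hj₀,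
      hj₀, ← ValuationSubring.valuation_le_one_iff, ← ValuationSubring.valuation_le_one_iff,
      map_div₀, map_div₀, div_le_one₀ (zero_lt_iff.2 (by simpa using hq0)),
      div_le_one₀ (zero_lt_iff.2 (by simpa using hq0')), h]
  obtain ⟨Ω, hΩ, O, i, j, hij, hi, hj⟩ := exists_valued_amalgam i₀ j₀ A B hcomap
  refine ⟨Ω, hΩ, O, i, j, fun r => ?_, hi, hj⟩
  let d : D := ⟨f r, r, rfl⟩
  have h1 := RingHom.congr_fun hij (algebraMap D F d)
  rw [RingHom.comp_apply, RingHom.comp_apply, hi₀, hj₀, hs, hker (s d) r (hs d)] at h1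
  exact h1

/-- A root taken in `M` is, inside `Ω`, a root of a polynomial that already splits over `N`. -/
theorem isAlgClosed_comap_fieldRange {M N Ω : Type*} [Field M] [Field N] [Field Ω] [IsAlgClosed M]
    [IsAlgClosed N] (i : M →+* Ω) (j : N →+* Ω) (α : j.fieldRange.comap i →+* N)
    (hα : j.comp α = i.comp (Subfield.subtype _)) : IsAlgClosed (j.fieldRange.comap i) := by
  refine IsAlgClosed.of_exists_root _ fun p _ hp => ?_
  obtain ⟨x, hx⟩ := IsAlgClosed.exists_eval₂_eq_zero (Subfield.subtype (j.fieldRange.comap i)) p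
    hp.degree_pos.ne'
  have h1 : (p.map α).eval₂ j (i x) = 0 := by
    rw [Polynomial.eval₂_map, hα, ← Polynomial.hom_eval₂, hx, map_zero]
  have h0 : p.map α ≠ 0 := (Polynomial.map_ne_zero_iff α.injective).2 hp.ne_zero
  have h2 : i x ∈ j.fieldRange := by
    rw [(IsAlgClosed.splits (p.map α)).eq_prod_roots, ← Polynomial.coe_eval₂RingHom, map_mul,
      map_multiset_prod, mul_eq_zero, or_iff_right (by simpa using h0), Multiset.prod_eq_zero_iff,
      Multiset.map_map, Multiset.mem_map] at h1
    obtain ⟨r, -, hr⟩ := h1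
    refine ⟨r, ?_⟩
    exact (sub_eq_zero.1 (by simpa using hr.symm.symm)).symm
  refine ⟨⟨x, h2⟩, Subtype.ext ?_⟩
  have := Polynomial.hom_eval₂ p (RingHom.id _) (Subfield.subtype (j.fieldRange.comap i)) ⟨x, h2⟩
  rw [RingHom.comp_id] at this
  exact this.trans hx

/-- The one-step extension needed for quantifier elimination. In the amalgam, the part `C` of `M`
identified with elements of `N` is algebraically closed and contains the image of `R`, so
`exists_same_comparisons` applies over it. -/
theorem exists_point_of_same_comparisons {R : Type*} {M N : Type u} [CommRing R] [Field M]
    [Field N] [IsAlgClosed M] [IsAlgClosed N] (A : ValuationSubring M) (B : ValuationSubring N)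
    (hB : ∃ x, x ≠ 0 ∧ B.valuation x < 1) (f : R →+* M) (g : R →+* N)
    (h : ∀ p q, A.valuation (f p) ≤ A.valuation (f q) ↔ B.valuation (g p) ≤ B.valuation (g q))
    (s : Finset (Polynomial R)) (y : M) :
    ∃ y' : N, ∀ P ∈ s, ∀ Q ∈ s,
      (A.valuation (P.eval₂ f y) ≤ A.valuation (Q.eval₂ f y) ↔
        B.valuation (P.eval₂ g y') ≤ B.valuation (Q.eval₂ g y')) := by
  classical
  obtain ⟨Ω, hΩ, O, i, j, hij, hi, hj⟩ := exists_valued_amalgam_of_same_comparisons A B f g h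
  let C := j.fieldRange.comap i
  let c : C → N := fun x => x.2.choose
  have hc : ∀ x : C, j (c x) = i x := fun x => x.2.choose_spec
  let α : C →+* N :=
    { toFun := c
      map_one' := j.injective (by rw [hc, map_one]; exact map_one i)
      map_zero' := j.injective (by rw [hc, map_zero]; exact map_zero i)
      map_mul' := fun x y => j.injective (by simp [hc])
      map_add' := fun x y => j.injective (by simp [hc]) }
  have := isAlgClosed_comap_fieldRange i j α (RingHom.ext hc)
  let f' : R →+* C := f.codRestrict C.toSubring fun r => ⟨g r, (hij r).symm⟩
  have hf' : (j.comp α).comp f' = i.comp f := RingHom.ext fun r => hc _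
  have hg' : α.comp f' = g := RingHom.ext fun r => j.injective ((hc _).trans (hij r))
  have hB' : ∃ x : N, x ≠ 0 ∧ O.valuation (j x) < 1 := by
    obtain ⟨x, hx, hx1⟩ := hB
    refine ⟨x, hx, ?_⟩
    rw [← not_le, ← map_one O.valuation, ← map_one j, valuation_le_iff_of_comap_eq O B j hj,
      map_one, not_le]
    exact hx1
  obtain ⟨y', hy'⟩ := exists_same_comparisons O.valuation α j hB'
    (s.image (Polynomial.map f')) (i y)
  refine ⟨y', fun P hP Q hQ => ?_⟩
  have := hy' _ (Finset.mem_image_of_mem _ hP) _ (Finset.mem_image_of_mem _ hQ)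
  rw [Polynomial.eval₂_map, Polynomial.eval₂_map, Polynomial.eval₂_map, Polynomial.eval₂_map, hf',
    hg', ← Polynomial.hom_eval₂, ← Polynomial.hom_eval₂, valuation_le_iff_of_comap_eq O A i hi,
    valuation_le_iff_of_comap_eq O B j hj] at this
  exact this

/-! ### A semantic criterion for quantifier elimination. -/

section QuantifierElimination

open FirstOrder.Language

variable {L : FirstOrder.Language.{0, 0}} {T : L.Theory} {α : Type}

/-- Compactness, with the free variables turned into new constants. -/
theorem exists_finset_not_realize (Γ : Set (L.Formula α))
    (h : ∀ (M : Theory.ModelType.{0, 0, 0} T) (a : α → M), ¬∀ ψ ∈ Γ, ψ.Realize a) :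
    ∃ Γ₀ : Finset (L.Formula α), ↑Γ₀ ⊆ Γ ∧
      ∀ (M : Theory.ModelType.{0, 0, 0} T) (a : α → M), ¬∀ ψ ∈ Γ₀, ψ.Realize a := by
  classical
  let T' : L[[α]].Theory := (L.lhomWithConstants α).onTheory T ∪ Formula.equivSentence '' Γ
  have hT' : T' ⊨ᵇ (⊥ : L[[α]].Sentence) := by
    refine Theory.models_sentence_iff.2 fun M => ?_
    let := (L.lhomWithConstants α).reduct M
    have hM : M ⊨ T' := M.is_model
    have hMT : M ⊨ T :=
      (LHom.onTheory_model (L.lhomWithConstants α) T).1 (hM.mono Set.subset_union_left)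
    refine (h (Theory.ModelType.of T M) (fun a => (L.con a : M)) fun ψ hψ => ?_).elim
    exact (Formula.realize_equivSentence M ψ).1
      (Theory.realize_sentence_of_mem T' (Or.inr ⟨ψ, hψ, rfl⟩))
  obtain ⟨T₀, hT₀, hbot⟩ := Theory.models_iff_finset_models.1 hT'
  refine ⟨(T₀.image Formula.equivSentence.symm).filter (· ∈ Γ),
    fun ψ hψ => (Finset.mem_filter.1 hψ).2, fun M a ha => ?_⟩
  let : (constantsOn α).Structure M := constantsOn.structure a
  have hM : M ⊨ (T₀ : L[[α]].Theory) := by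
    refine (Theory.model_iff _).2 fun θ hθ => ?_
    rcases hT₀ hθ with h1 | ⟨ψ, hψ, rfl⟩
    · exact ((LHom.onTheory_model (L.lhomWithConstants α) T).2 M.is_model).realize_of_mem θ h1
    · refine (Formula.realize_equivSentence M ψ).2 (ha ψ (Finset.mem_filter.2 ⟨?_, hψ⟩))
      exact Finset.mem_image.2 ⟨_, hθ, Equiv.symm_apply_apply _ _⟩
  exact hbot.realize_sentence M

theorem exists_conj_formula (s : Finset (L.Formula α)) (hs : ∀ ψ ∈ s, BoundedFormula.IsQF ψ) :
    ∃ θ : L.Formula α, BoundedFormula.IsQF θ ∧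
      ∀ (M : Type) [L.Structure M] (a : α → M), θ.Realize a ↔ ∀ ψ ∈ s, ψ.Realize a := by
  refine ⟨s.toList.foldr (· ⊓ ·) ⊤, ?_, fun M _ a => ?_⟩
  · have : ∀ l : List (L.Formula α), (∀ ψ ∈ l, BoundedFormula.IsQF ψ) →
        BoundedFormula.IsQF (l.foldr (· ⊓ ·) ⊤ : L.Formula α) := by
      intro l
      induction l with
      | nil => exact fun _ => BoundedFormula.IsQF.top
      | cons φ l ih =>
        intro h
        exact (h φ List.mem_cons_self).inf (ih fun ψ hψ => h ψ (List.mem_cons_of_mem _ hψ))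
    exact this _ fun ψ hψ => hs ψ (Finset.mem_toList.1 hψ)
  · simp [Formula.Realize]

/-- Compactness twice: first each point outside `φ` is separated from all of `φ` by one
quantifier-free formula, then finitely many quantifier-free consequences of `φ` suffice to imply it.
-/
theorem exists_isQF_iff_of_preserved (φ : L.Formula α)
    (h : ∀ (M N : Theory.ModelType.{0, 0, 0} T) (a : α → M) (b : α → N),
      (∀ ψ : L.Formula α, BoundedFormula.IsQF ψ → (ψ.Realize a ↔ ψ.Realize b)) →
        φ.Realize a → φ.Realize b) :
    ∃ θ : L.Formula α, BoundedFormula.IsQF θ ∧ T ⊨ᵇ φ.iff θ := by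
  classical
  have key : ∀ (N : Theory.ModelType.{0, 0, 0} T) (b : α → N), ¬ φ.Realize b → ∃ δ : L.Formula α,
      BoundedFormula.IsQF δ ∧ δ.Realize b ∧ ∀ (M : Theory.ModelType.{0, 0, 0} T) (a : α → M),
        φ.Realize a → ¬ δ.Realize a := by
    intro N b hb
    let Δ : Set (L.Formula α) := {ψ | BoundedFormula.IsQF ψ ∧ ψ.Realize b}
    obtain ⟨Γ₀, hΓ₀, hinc⟩ := exists_finset_not_realize (T := T) (insert φ Δ) (by
      intro M a ha
      refine hb (h M N a b (fun ψ hψ => ⟨fun hψa => ?_, fun hψb => ?_⟩)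
        (ha φ (Set.mem_insert _ _)))
      · by_contra hψb
        exact (Formula.realize_not.1
          (ha ψ.not (Set.mem_insert_of_mem _ ⟨hψ.not, Formula.realize_not.2 hψb⟩))) hψa
      · exact ha ψ (Set.mem_insert_of_mem _ ⟨hψ, hψb⟩))
    obtain ⟨δ, hδ, hδr⟩ := exists_conj_formula (Γ₀.filter (· ∈ Δ))
      fun ψ hψ => (Finset.mem_filter.1 hψ).2.1
    refine ⟨δ, hδ, (hδr N b).2 fun ψ hψ => (Finset.mem_filter.1 hψ).2.2, fun M a ha hδa => ?_⟩
    refine hinc M a fun ψ hψ => ?_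
    rcases hΓ₀ hψ with rfl | h1
    · exact ha
    · exact (hδr M a).1 hδa ψ (Finset.mem_filter.2 ⟨hψ, h1⟩)
  let Δ : Set (L.Formula α) :=
    {ψ | BoundedFormula.IsQF ψ ∧ ∀ (M : Theory.ModelType.{0, 0, 0} T) (a : α → M),
      φ.Realize a → ψ.Realize a}
  obtain ⟨Γ₀, hΓ₀, hinc⟩ := exists_finset_not_realize (T := T) (insert φ.not Δ) (by
    intro N b hb
    obtain ⟨δ, hδ, hδb, hδφ⟩ := key N b (Formula.realize_not.1 (hb _ (Set.mem_insert _ _)))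
    exact Formula.realize_not.1 (hb δ.not (Set.mem_insert_of_mem _
      ⟨hδ.not, fun M a ha => Formula.realize_not.2 (hδφ M a ha)⟩)) hδb)
  obtain ⟨θ, hθ, hθr⟩ := exists_conj_formula (Γ₀.filter (· ∈ Δ))
    fun ψ hψ => (Finset.mem_filter.1 hψ).2.1
  refine ⟨θ, hθ, Theory.models_formula_iff.2 fun M a => Formula.realize_iff.2
    ⟨fun ha => (hθr M a).2 fun ψ hψ => (Finset.mem_filter.1 hψ).2.2 M a ha, fun ha => ?_⟩⟩
  by_contra hφ
  refine hinc M a fun ψ hψ => ?_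
  rcases hΓ₀ hψ with rfl | h1
  · exact Formula.realize_not.2 hφ
  · exact (hθr M a).1 ha ψ (Finset.mem_filter.2 ⟨hψ, h1⟩)

theorem exists_isQF_iff (h : ∀ (n : ℕ) (φ : L.BoundedFormula α (n + 1)), φ.IsQF →
    ∀ (M N : Theory.ModelType.{0, 0, 0} T) (a : α ⊕ Fin n → M) (b : α ⊕ Fin n → N),
      (∀ ψ : L.Formula (α ⊕ Fin n), BoundedFormula.IsQF ψ → (ψ.Realize a ↔ ψ.Realize b)) →
      ∀ x : M, φ.Realize (a ∘ Sum.inl) (Fin.snoc (a ∘ Sum.inr) x) →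
        ∃ y : N, φ.Realize (b ∘ Sum.inl) (Fin.snoc (b ∘ Sum.inr) y)) {n : ℕ}
    (φ : L.BoundedFormula α n) :
    ∃ θ : L.BoundedFormula α n, θ.IsQF ∧ T ⊨ᵇ φ.iff θ := by
  refine φ.induction_on_exists_not
    (P := fun {m} φ => ∃ θ : L.BoundedFormula α m, θ.IsQF ∧ T ⊨ᵇ φ.iff θ) ?_ ?_ ?_ ?_
  · intro m ψ hψ
    exact ⟨ψ, hψ, fun M v xs => BoundedFormula.realize_iff.2 Iff.rfl⟩
  · rintro m φ ⟨θ, hθ, hθφ⟩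
    refine ⟨θ.not, hθ.not, fun M v xs => BoundedFormula.realize_iff.2 ?_⟩
    rw [BoundedFormula.realize_not, BoundedFormula.realize_not]
    exact not_congr (BoundedFormula.realize_iff.1 (hθφ M v xs))
  · rintro m φ ⟨θ, hθ, hθφ⟩
    obtain ⟨χ, hχ, hχθ⟩ := exists_isQF_iff_of_preserved (T := T) θ.ex.toFormula (by
      intro M N a b hab hMa
      rw [BoundedFormula.realize_toFormula, BoundedFormula.realize_ex] at hMa ⊢
      obtain ⟨x, hx⟩ := hMa
      exact h m θ hθ M N a b hab x hx)
    refine ⟨BoundedFormula.relabel (n := m) (k := 0) id χ, hχ.relabel _, fun M v xs => ?_⟩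
    have h1 := Formula.realize_iff.1 (Theory.models_formula_iff.1 hχθ M (Sum.elim v xs))
    rw [BoundedFormula.realize_toFormula, Sum.elim_comp_inl, Sum.elim_comp_inr] at h1
    refine BoundedFormula.realize_iff.2 (Iff.trans ?_ (h1.trans ?_))
    · rw [BoundedFormula.realize_ex, BoundedFormula.realize_ex]
      exact exists_congr fun x => BoundedFormula.realize_iff.1 (hθφ M v (Fin.snoc xs x))
    · rw [BoundedFormula.realize_relabel, Function.comp_id, Formula.Realize]
      exact iff_of_eq (congr rfl (Subsingleton.elim _ _))
  · intro m φ₁ φ₂ h12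
    have h12' : ∀ (M : Theory.ModelType.{0, 0, 0} T) (v : α → M) (xs : Fin m → M),
        φ₁.Realize v xs ↔ φ₂.Realize v xs := fun M v xs => h12.realize_bd_iff
    refine exists_congr fun θ => and_congr_right fun _ => forall_congr' fun M =>
      forall_congr' fun v => forall_congr' fun xs => ?_
    rw [BoundedFormula.realize_iff, BoundedFormula.realize_iff, h12' M v xs]

end QuantifierElimination

/-! ### Terms as integer polynomials, and elimination for algebraically closed valued fields. -/

section Terms

open FirstOrder.Language FirstOrder.Ring

/-- The function symbols of the language of valued fields, evaluated in a commutative ring. -/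
def funValue {R : Type*} [CommRing R] {n : ℕ} (f : valuedFieldLanguage.Functions n)
    (x : Fin n → R) : R :=
  Sum.elim (fun g : Language.ring.Functions n => (compatibleRingOfRing R).toStructure.funMap g x)
    (fun e : Empty => e.elim) f

/-- The value of a term of the language of valued fields in a commutative ring. -/
def termValue {R β : Type*} [CommRing R] (ρ : β → R) : valuedFieldLanguage.Term β → R
  | .var i => ρ i
  | .func f ts => funValue f fun i => termValue ρ (ts i)

theorem map_funValue {R S : Type*} [CommRing R] [CommRing S] (h : R →+* S) {n : ℕ}
    (f : valuedFieldLanguage.Functions n) (x : Fin n → R) :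
    h (funValue f x) = funValue f fun i => h (x i) := by
  rcases f with f | f
  · rcases f with _ | _ | _ | _ | _
    · exact map_add h _ _
    · exact map_mul h _ _
    · exact map_neg h _
    · exact map_zero h
    · exact map_one h
  · exact f.elim

theorem map_termValue {R S β : Type*} [CommRing R] [CommRing S] (h : R →+* S) (ρ : β → R)
    (t : valuedFieldLanguage.Term β) : h (termValue ρ t) = termValue (fun i => h (ρ i)) t := by
  induction t with
  | var i => rfl
  | func f ts ih =>
    rw [termValue, map_funValue, termValue]
    exact congrArg (funValue f) (funext ih)

/-- The term of the language of valued fields given by a function symbol of the language of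
rings. -/
def ringTerm {β : Type*} {n : ℕ} (f : Language.ring.Functions n)
    (ts : Fin n → valuedFieldLanguage.Term β) : valuedFieldLanguage.Term β :=
  .func (Sum.inl f : valuedFieldLanguage.Functions n) ts

section

variable {R β : Type*} [CommRing R] (ρ : β → R) (s t : valuedFieldLanguage.Term β)

theorem termValue_add : termValue ρ (ringTerm addFunc ![s, t]) = termValue ρ s + termValue ρ t :=
  rfl

theorem termValue_mul : termValue ρ (ringTerm mulFunc ![s, t]) = termValue ρ s * termValue ρ t :=
  rfl

theorem termValue_neg : termValue ρ (ringTerm negFunc ![s]) = -termValue ρ s := rfl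

theorem termValue_zero : termValue ρ (ringTerm zeroFunc ![]) = 0 := rfl

theorem termValue_one : termValue ρ (ringTerm oneFunc ![]) = 1 := rfl

end

theorem exists_termValue_eq_mvPolynomial {β : Type*} (p : MvPolynomial β ℤ) :
    ∃ t : valuedFieldLanguage.Term β, termValue MvPolynomial.X t = p := by
  induction p using MvPolynomial.induction_on with
  | C a =>
    induction a using Int.induction_on with
    | zero => exact ⟨ringTerm zeroFunc ![], by rw [termValue_zero, map_zero]⟩
    | succ i ih =>
      obtain ⟨t, ht⟩ := ih
      exact ⟨ringTerm addFunc ![t, ringTerm oneFunc ![] ], by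
        rw [termValue_add, termValue_one, ht, map_add, map_one]⟩
    | pred i ih =>
      obtain ⟨t, ht⟩ := ih
      exact ⟨ringTerm addFunc ![t, ringTerm negFunc ![ringTerm oneFunc ![] ] ], by
        rw [termValue_add, termValue_neg, termValue_one, ht, map_sub, map_one, sub_eq_add_neg]⟩
  | add p q hp hq =>
    obtain ⟨s, rfl⟩ := hp
    obtain ⟨t, rfl⟩ := hq
    exact ⟨_, termValue_add _ s t⟩
  | mul_X p i hp =>
    obtain ⟨s, rfl⟩ := hp
    exact ⟨_, termValue_mul _ s (.var i)⟩

end Terms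

/-- The relation symbol of the language of valued fields. -/
def divRel : valuedFieldLanguage.Relations 2 :=
  Sum.inr (DivRel.div : divLanguage.Relations 2)

theorem eq_divRel {n : ℕ} (R : valuedFieldLanguage.Relations n) :
    ∃ h : 2 = n, R = h ▸ divRel := by
  rcases R with R | R
  · exact R.elim
  · rcases R with _ | _
    exact ⟨rfl, rfl⟩

/-- The structure on `N` is the one given by the field operations and the valuation ring `O`. -/
structure IsValuedField (N : Type*) [valuedFieldLanguage.Structure N] [Field N]
    (O : ValuationSubring N) : Prop where
  funMap_eq : ∀ {n : ℕ} (f : valuedFieldLanguage.Functions n) (x : Fin n → N),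
    Language.Structure.funMap f x = funValue f x
  relMap_iff : ∀ x : Fin 2 → N,
    Language.Structure.RelMap divRel x ↔
      O.valuation (x 1) ≤ O.valuation (x 0)

theorem realize_term {N β : Type*} [valuedFieldLanguage.Structure N] [Field N]
    (h : ∀ {n : ℕ} (f : valuedFieldLanguage.Functions n) (x : Fin n → N),
      Language.Structure.funMap f x = funValue f x)
    (t : valuedFieldLanguage.Term β) (a : β → N) : t.realize a = termValue a t := by
  induction t with
  | var i => rfl
  | func f ts ih =>
    rw [Language.Term.realize_func, h, termValue]
    exact congrArg (funValue f) (funext ih)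

/-- The formula `s div t`. -/
def divFormula {β : Type*} (s t : valuedFieldLanguage.Term β) : valuedFieldLanguage.Formula β :=
  Language.Relations.formula divRel ![s, t]

theorem divFormula_isQF {β : Type*} (s t : valuedFieldLanguage.Term β) :
    Language.BoundedFormula.IsQF (divFormula s t) :=
  (Language.BoundedFormula.IsAtomic.rel _ _).isQF

/-- The order reverses because `div` is read additively while `O.valuation` is multiplicative. -/
theorem IsValuedField.realize_divFormula {N : Type*} [valuedFieldLanguage.Structure N] [Field N]
    {O : ValuationSubring N} (h : IsValuedField N O) {β : Type*}
    (s t : valuedFieldLanguage.Term β) (a : β → N) :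
    (divFormula s t).Realize a ↔ O.valuation (termValue a t) ≤ O.valuation (termValue a s) := by
  rw [divFormula, Language.Formula.realize_rel, h.relMap_iff, ← realize_term h.funMap_eq,
    ← realize_term h.funMap_eq]
  rfl

theorem same_comparisons_of_same_isQF {M N : Type*} [valuedFieldLanguage.Structure M]
    [valuedFieldLanguage.Structure N] [Field M] [Field N] {A : ValuationSubring M}
    {B : ValuationSubring N} (hA : IsValuedField M A) (hB : IsValuedField N B) {β : Type}
    (a : β → M) (b : β → N) (h : ∀ ψ : valuedFieldLanguage.Formula β,
      Language.BoundedFormula.IsQF ψ → (ψ.Realize a ↔ ψ.Realize b)) (p q : MvPolynomial β ℤ) :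
    A.valuation (MvPolynomial.eval₂Hom (Int.castRingHom M) a p) ≤
        A.valuation (MvPolynomial.eval₂Hom (Int.castRingHom M) a q) ↔
      B.valuation (MvPolynomial.eval₂Hom (Int.castRingHom N) b p) ≤
        B.valuation (MvPolynomial.eval₂Hom (Int.castRingHom N) b q) := by
  obtain ⟨s, rfl⟩ := exists_termValue_eq_mvPolynomial p
  obtain ⟨t, rfl⟩ := exists_termValue_eq_mvPolynomial q
  have := h _ (divFormula_isQF t s)
  rw [hA.realize_divFormula, hB.realize_divFormula] at this
  simpa only [map_termValue, MvPolynomial.coe_eval₂Hom, MvPolynomial.eval₂_X] using this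

/-- The last bounded variable as the variable of a polynomial over the other variables. -/
noncomputable def lastVar {α : Type} {n : ℕ} :
    α ⊕ Fin (n + 1) → Polynomial (MvPolynomial (α ⊕ Fin n) ℤ) :=
  Sum.elim (fun i => Polynomial.C (MvPolynomial.X (Sum.inl i)))
    (Fin.snoc (α := fun _ => Polynomial (MvPolynomial (α ⊕ Fin n) ℤ))
      (fun i => Polynomial.C (MvPolynomial.X (Sum.inr i))) Polynomial.X)

theorem eval₂_lastVar {α : Type} {n : ℕ} {N : Type*} [Field N] (a : α ⊕ Fin n → N) (x : N)
    (t : valuedFieldLanguage.Term (α ⊕ Fin (n + 1))) :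
    (termValue lastVar t).eval₂ (MvPolynomial.eval₂Hom (Int.castRingHom N) a) x =
      termValue (Sum.elim (a ∘ Sum.inl) (Fin.snoc (a ∘ Sum.inr) x)) t := by
  rw [← Polynomial.coe_eval₂RingHom, map_termValue]
  congr 1
  ext (i | i)
  · simp [lastVar]
  · refine Fin.lastCases ?_ (fun i => ?_) i
    · simp [lastVar]
    · simp [lastVar]

theorem exists_finset_determining {α : Type} {n : ℕ}
    (φ : valuedFieldLanguage.BoundedFormula α (n + 1)) (hφ : φ.IsQF) :
    ∃ s : Finset (Polynomial (MvPolynomial (α ⊕ Fin n) ℤ)),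
      ∀ (M N : Type) [valuedFieldLanguage.Structure M] [valuedFieldLanguage.Structure N]
        [Field M] [Field N] (A : ValuationSubring M) (B : ValuationSubring N)
        (_ : IsValuedField M A) (_ : IsValuedField N B) (a : α ⊕ Fin n → M) (b : α ⊕ Fin n → N)
        (x : M) (y : N),
        (∀ P ∈ s, ∀ Q ∈ s,
          (A.valuation (P.eval₂ (MvPolynomial.eval₂Hom (Int.castRingHom M) a) x) ≤
              A.valuation (Q.eval₂ (MvPolynomial.eval₂Hom (Int.castRingHom M) a) x) ↔
            B.valuation (P.eval₂ (MvPolynomial.eval₂Hom (Int.castRingHom N) b) y) ≤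
              B.valuation (Q.eval₂ (MvPolynomial.eval₂Hom (Int.castRingHom N) b) y))) →
          (φ.Realize (a ∘ Sum.inl) (Fin.snoc (a ∘ Sum.inr) x) ↔
            φ.Realize (b ∘ Sum.inl) (Fin.snoc (b ∘ Sum.inr) y)) := by
  classical
  induction hφ with
  | falsum => exact ⟨∅, fun _ _ _ _ _ _ _ _ _ _ _ _ _ _ _ => Iff.rfl⟩
  | of_isAtomic hat =>
    rcases hat with ⟨t₁, t₂⟩ | ⟨R, ts⟩
    -- An equation is the comparison of the difference with 0.
    · refine ⟨{termValue lastVar t₁ - termValue lastVar t₂, 0}, ?_⟩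
      intro M N _ _ _ _ A B hA hB a b x y h
      have := h _ (Finset.mem_insert_self _ _) 0 (by simp)
      rw [Polynomial.eval₂_zero, Polynomial.eval₂_zero, map_zero, map_zero, le_zero_iff,
        le_zero_iff, map_eq_zero, map_eq_zero, Polynomial.eval₂_sub, Polynomial.eval₂_sub,
        sub_eq_zero, sub_eq_zero] at this
      simpa only [Language.BoundedFormula.realize_bdEqual, realize_term hA.funMap_eq,
        realize_term hB.funMap_eq,
        eval₂_lastVar] using this
    · obtain ⟨rfl, rfl⟩ := eq_divRel R
      refine ⟨{termValue lastVar (ts 0), termValue lastVar (ts 1)}, ?_⟩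
      intro M N _ _ _ _ A B hA hB a b x y h
      have := h (termValue lastVar (ts 1)) (by simp) (termValue lastVar (ts 0)) (by simp)
      rw [Language.BoundedFormula.realize_rel, Language.BoundedFormula.realize_rel,
          hA.relMap_iff, hB.relMap_iff]
      simpa only [realize_term hA.funMap_eq, realize_term hB.funMap_eq, eval₂_lastVar] using this
  | imp _ _ ih₁ ih₂ =>
    obtain ⟨s₁, h₁⟩ := ih₁
    obtain ⟨s₂, h₂⟩ := ih₂
    refine ⟨s₁ ∪ s₂, ?_⟩
    intro M N _ _ _ _ A B hA hB a b x y h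
    rw [Language.BoundedFormula.realize_imp, Language.BoundedFormula.realize_imp,
      h₁ M N A B hA hB a b x y fun P hP Q hQ =>
        h P (Finset.mem_union_left _ hP) Q (Finset.mem_union_left _ hQ),
      h₂ M N A B hA hB a b x y fun P hP Q hQ =>
        h P (Finset.mem_union_right _ hP) Q (Finset.mem_union_right _ hQ)]

/-- `N` is an algebraically closed field with the nontrivial valuation ring `O`. -/
structure IsACVF (N : Type*) [valuedFieldLanguage.Structure N] [Field N]
    (O : ValuationSubring N) : Prop extends IsValuedField N O where
  isAlgClosed : IsAlgClosed N
  nontrivial : ∃ x, x ≠ 0 ∧ O.valuation x < 1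

theorem exists_isQF_iff_of_isACVF {T : valuedFieldLanguage.Theory}
    (hT : ∀ M : Language.Theory.ModelType.{0, 0, 0} T,
      ∃ (_ : Field M) (O : ValuationSubring M), IsACVF M O) {α : Type} {n : ℕ}
    (φ : valuedFieldLanguage.BoundedFormula α n) :
    ∃ θ : valuedFieldLanguage.BoundedFormula α n, θ.IsQF ∧ T ⊨ᵇ φ.iff θ := by
  refine exists_isQF_iff (fun n φ hφ M N a b hab x hx => ?_) φ
  obtain ⟨s, hs⟩ := exists_finset_determining φ hφ
  obtain ⟨_, A, hA⟩ := hT M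
  obtain ⟨_, B, hB⟩ := hT N
  have := hA.isAlgClosed
  have := hB.isAlgClosed
  obtain ⟨y, hy⟩ := exists_point_of_same_comparisons A B hB.nontrivial
    (MvPolynomial.eval₂Hom (Int.castRingHom M) a) (MvPolynomial.eval₂Hom (Int.castRingHom N) b)
    (same_comparisons_of_same_isQF hA.toIsValuedField hB.toIsValuedField a b hab) s x
  exact ⟨y, (hs M N A B hA.toIsValuedField hB.toIsValuedField a b x y hy).1 hx⟩

/-! ### Spherical completeness and algebraic closedness of the Hahn field. -/

section HahnField

variable {k L Γ₀ : Type*} [Field k] [Field L] [LinearOrderedCommGroupWithZero Γ₀]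

/-- `w` is a valuation on `L` which extends the one of the Hahn field along `ι`. -/
def ExtendsHahn (w : Valuation L Γ₀) (ι : HahnSeries ℝ k →+* L) : Prop :=
  ∀ x y, w (ι x) ≤ w (ι y) ↔ y.orderTop ≤ x.orderTop

namespace ExtendsHahn

variable {w : Valuation L Γ₀} {ι : HahnSeries ℝ k →+* L} (h : ExtendsHahn w ι)

include h

theorem lt_iff (x y : HahnSeries ℝ k) : w (ι x) < w (ι y) ↔ y.orderTop < x.orderTop := by
  rw [← not_le, ← not_le, h]

theorem eq_of_orderTop_eq {x y : HahnSeries ℝ k} (hxy : x.orderTop = y.orderTop) :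
    w (ι x) = w (ι y) :=
  le_antisymm ((h x y).2 hxy.ge) ((h y x).2 hxy.le)

theorem eq_single {x : HahnSeries ℝ k} (hx : x ≠ 0) :
    w (ι x) = w (ι (HahnSeries.single x.order 1)) :=
  h.eq_of_orderTop_eq (by
    rw [HahnSeries.orderTop_single one_ne_zero, HahnSeries.order_eq_orderTop_of_ne_zero hx])

theorem single_le_single {r s : ℝ} :
    w (ι (HahnSeries.single r 1)) ≤ w (ι (HahnSeries.single s 1)) ↔ s ≤ r := by
  rw [h, HahnSeries.orderTop_single one_ne_zero, HahnSeries.orderTop_single one_ne_zero,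
    WithTop.coe_le_coe]

theorem coeff_eq_zero {x : HahnSeries ℝ k} {r : ℝ} (hx : w (ι x) < w (ι (HahnSeries.single r 1))) :
    x.coeff r = 0 := by
  rw [h.lt_iff, HahnSeries.orderTop_single one_ne_zero] at hx
  exact HahnSeries.coeff_eq_zero_of_lt_orderTop hx

/-- Spherical completeness, with radii allowed in the value group of the larger field. A ball
prescribes the coefficients at all exponents `r` with `ρ i < τ r`; compatibility makes these
prescriptions agree, and they are glued, with 0 where none applies. -/
theorem exists_mem_balls {I : Type*} (a : I → HahnSeries ℝ k) (ρ : I → Γ₀)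
    (ha : ∀ i j, w (ι (a i - a j)) ≤ max (ρ i) (ρ j)) :
    ∃ b, ∀ i, w (ι (b - a i)) ≤ ρ i := by
  classical
  let τ : ℝ → Γ₀ := fun r => w (ι (HahnSeries.single r 1))
  let c : ℝ → k := fun r => if hr : ∃ i, ρ i < τ r then (a hr.choose).coeff r else 0
  have hc : ∀ i r, ρ i < τ r → c r = (a i).coeff r := by
    intro i r hi
    have hr : ∃ i, ρ i < τ r := ⟨i, hi⟩
    simp only [c, dif_pos hr]
    rw [← sub_eq_zero, ← HahnSeries.coeff_sub]
    exact h.coeff_eq_zero ((ha _ _).trans_lt (max_lt hr.choose_spec hi))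
  -- A ball prescribing the first exponent of a descending sequence prescribes all later ones, so
  -- the sequence would lie in the support of a single `a i`.
  have hpwo : (Function.support c).IsPWO := by
    refine Set.IsWF.isPWO (Set.isWF_iff_no_descending_seq.2 fun f hf hmem => ?_)
    obtain ⟨i, hi⟩ : ∃ i, ρ i < τ (f 0) := by
      by_contra hne
      exact hmem 0 (dif_neg hne)
    refine Set.isWF_iff_no_descending_seq.1 (a i).isWF_support f hf fun n => ?_
    have : τ (f 0) ≤ τ (f n) := h.single_le_single.2 (hf.antitone (Nat.zero_le n))
    have h1 := hmem n
    rw [Function.mem_support, hc i _ (hi.trans_le this)] at h1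
    exact h1
  refine ⟨⟨c, hpwo⟩, fun i => ?_⟩
  by_contra! hlt
  have h0 : (⟨c, hpwo⟩ - a i : HahnSeries ℝ k) ≠ 0 := by
    intro h0
    rw [h0, map_zero, map_zero] at hlt
    exact not_lt_zero hlt
  refine HahnSeries.coeff_orderTop_ne (HahnSeries.order_eq_orderTop_of_ne_zero h0).symm ?_
  rw [h.eq_single h0] at hlt
  rw [HahnSeries.coeff_sub, sub_eq_zero]
  exact hc i _ hlt

/-- A common point of the balls around each `a` of radius `w (y - ι a)`. -/
theorem exists_best_approximation (y : L) : ∃ b, ∀ a, w (y - ι b) ≤ w (y - ι a) := by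
  obtain ⟨b, hb⟩ := h.exists_mem_balls id (fun a => w (y - ι a)) fun i j => by
    rw [map_sub]
    have : ι i - ι j = (y - ι j) - (y - ι i) := by ring
    rw [id, id, this, max_comm]
    exact w.map_sub _ _
  refine ⟨b, fun a => ?_⟩
  have h1 : y - ι b = (y - ι a) - ι (b - a) := by rw [map_sub]; ring
  rw [h1]
  exact (w.map_sub _ _).trans (max_le le_rfl (hb a))

/-- In a vanishing sum two terms share the maximal value, so a positive power of `w y` is a value of
the Hahn field; divisibility of `ℝ` then allows division of the exponent. -/
theorem exists_valuation_eq {y : L} (hy : y ≠ 0) {p : Polynomial (HahnSeries ℝ k)} (hp : p ≠ 0)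
    (hpy : p.eval₂ ι y = 0) : ∃ c, c ≠ 0 ∧ w y = w (ι c) := by
  classical
  have hwy : w y ≠ 0 := by simpa using hy
  have hne : ∀ i ∈ p.support, w (ι (p.coeff i) * y ^ i) ≠ 0 := fun i hi => by
    simpa [hy] using Polynomial.mem_support_iff.1 hi
  have hsum : ∑ i ∈ p.support, ι (p.coeff i) * y ^ i = 0 := by
    rw [← hpy, Polynomial.eval₂_eq_sum, Polynomial.sum_def]
  obtain ⟨j, hj, hjmax⟩ := Finset.exists_max_image p.support (fun i => w (ι (p.coeff i) * y ^ i))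
    (Polynomial.support_nonempty.2 hp)
  obtain ⟨i, hi, hij, heq⟩ : ∃ i ∈ p.support, i ≠ j ∧
      w (ι (p.coeff i) * y ^ i) = w (ι (p.coeff j) * y ^ j) := by
    by_contra! hcon
    have := w.map_sum_eq_of_lt hj fun i hi => by
      obtain ⟨hi, hij⟩ := Finset.mem_sdiff.1 hi
      exact lt_of_le_of_ne (hjmax i hi) (hcon i hi (by simpa using hij))
    rw [hsum, map_zero] at this
    exact hne j hj this.symm
  have key : ∀ i j, i ∈ p.support → j ∈ p.support → i < j →
      w (ι (p.coeff i) * y ^ i) = w (ι (p.coeff j) * y ^ j) → ∃ c, c ≠ 0 ∧ w y = w (ι c) := by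
    intro i j hi hj hij heq
    obtain ⟨m, rfl⟩ := Nat.exists_eq_add_of_lt hij
    have hpi := Polynomial.mem_support_iff.1 hi
    have hpj := Polynomial.mem_support_iff.1 hj
    let q := p.coeff i / p.coeff (i + m + 1)
    have hq : q ≠ 0 := div_ne_zero hpi hpj
    have h1 : w y ^ (m + 1) = w (ι q) := by
      rw [map_mul, map_mul, map_pow, map_pow, add_assoc, pow_add, mul_comm (w y ^ i), ← mul_assoc]
        at heq
      have := mul_right_cancel₀ (pow_ne_zero i hwy) heq
      rw [map_div₀, map_div₀, this, add_assoc, mul_div_cancel_left₀]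
      simpa [add_assoc] using hpj
    refine ⟨HahnSeries.single (q.order / (m + 1 : ℕ)) 1, HahnSeries.single_ne_zero one_ne_zero, ?_⟩
    rw [← pow_left_inj₀ zero_le zero_le (Nat.succ_ne_zero m), Nat.succ_eq_add_one, h1,
      h.eq_single hq,
      ← map_pow, ← map_pow, HahnSeries.single_pow, one_pow, nsmul_eq_mul,
      mul_div_cancel₀ _ (by positivity)]
  rcases lt_or_gt_of_ne hij with hij | hij
  · exact key i j hi hj hij heq
  · exact key j i hj hi hij heq.symm

theorem exists_residue_approximation {x : HahnSeries ℝ k} (hx : w (ι x) ≤ 1) :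
    w (ι (x - HahnSeries.C (x.coeff 0))) < 1 := by
  rw [← map_one w, ← map_one ι] at hx ⊢
  rw [h, HahnSeries.orderTop_one] at hx
  rw [h.lt_iff, HahnSeries.orderTop_one]
  by_contra! hle
  obtain ⟨r, hr, hne⟩ : ∃ r : ℝ, r ≤ 0 ∧ (x - HahnSeries.C (x.coeff 0)).coeff r ≠ 0 := by
    have h0 : x - HahnSeries.C (x.coeff 0) ≠ 0 := fun h0 => by
      rw [h0, HahnSeries.orderTop_zero] at hle
      exact absurd hle (by simp)
    refine ⟨_, ?_, HahnSeries.coeff_orderTop_ne (HahnSeries.order_eq_orderTop_of_ne_zero h0).symm⟩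
    rw [← HahnSeries.order_eq_orderTop_of_ne_zero h0] at hle
    exact_mod_cast hle
  rw [HahnSeries.coeff_sub] at hne
  rcases hr.lt_or_eq with hr | rfl
  · refine hne ?_
    rw [HahnSeries.coeff_eq_zero_of_lt_orderTop (lt_of_lt_of_le (by exact_mod_cast hr) hx),
      HahnSeries.C_apply, HahnSeries.coeff_single_of_ne hr.ne, sub_zero]
  · exact hne (by simp)

theorem valuation_C {c : k} (hc : c ≠ 0) : w (ι (HahnSeries.C c)) = 1 := by
  rw [← map_one w, ← map_one ι]
  refine h.eq_of_orderTop_eq ?_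
  rw [HahnSeries.C_apply, HahnSeries.orderTop_single hc, HahnSeries.orderTop_one]
  rfl

/-- Dividing by a coefficient of largest value and reducing gives a nonzero `q` over `k` with `w
(q(u)) < 1`. As `q` splits over `k`, some factor `u - c` has value less than 1. -/
theorem exists_residue [IsAlgClosed k] {u : L} (hu : w u = 1) {p : Polynomial (HahnSeries ℝ k)}
    (hp : p ≠ 0) (hpu : p.eval₂ ι u = 0) : ∃ c : k, w (u - ι (HahnSeries.C c)) < 1 := by
  classical
  obtain ⟨j, hj, hjmax⟩ := Finset.exists_max_image p.support (fun i => w (ι (p.coeff i)))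
    (Polynomial.support_nonempty.2 hp)
  have hpj : p.coeff j ≠ 0 := Polynomial.mem_support_iff.1 hj
  let d : ℕ → HahnSeries ℝ k := fun i => p.coeff i / p.coeff j
  have hd : ∀ i, w (ι (d i)) ≤ 1 := by
    intro i
    rw [map_div₀, map_div₀]
    refine div_le_one_of_le₀ ?_ zero_le
    by_cases hi : i ∈ p.support
    · exact hjmax i hi
    · rw [Polynomial.notMem_support_iff.1 hi, map_zero, map_zero]
      exact zero_le
  let n := p.natDegree
  let q : Polynomial k := ∑ i ∈ Finset.range (n + 1), Polynomial.monomial i ((d i).coeff 0)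
  have hq : q ≠ 0 := by
    intro hq
    have h1 : q.coeff j = 1 := by
      have hjn : j ∈ Finset.range (n + 1) :=
        Finset.mem_range.2 (Nat.lt_succ_of_le (Polynomial.le_natDegree_of_ne_zero hpj))
      have hdj : d j = 1 := div_self hpj
      rw [Polynomial.finsetSum_coeff]
      simp only [Polynomial.coeff_monomial, Finset.sum_ite_eq', if_pos hjn, hdj]
      simp
    rw [hq, Polynomial.coeff_zero] at h1
    exact zero_ne_one h1
  have hsum : ∑ i ∈ Finset.range (n + 1), ι (d i) * u ^ i = 0 := by
    have h1 : ∀ i, ι (d i) * u ^ i = (ι (p.coeff j))⁻¹ * (ι (p.coeff i) * u ^ i) := fun i => by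
      rw [map_div₀]; ring
    rw [Finset.sum_congr rfl fun i _ => h1 i, ← Finset.mul_sum, ← Polynomial.eval₂_eq_sum_range,
      hpu, mul_zero]
  have hlt : w (q.eval₂ (ι.comp HahnSeries.C) u) < 1 := by
    have h1 : q.eval₂ (ι.comp HahnSeries.C) u =
        ∑ i ∈ Finset.range (n + 1), -(ι (d i - HahnSeries.C ((d i).coeff 0)) * u ^ i) := by
      rw [Polynomial.eval₂_finsetSum, ← sub_zero (Finset.sum _ _), ← hsum,
        ← Finset.sum_sub_distrib]
      refine Finset.sum_congr rfl fun i _ => ?_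
      rw [Polynomial.eval₂_monomial, map_sub, RingHom.comp_apply]
      ring
    rw [h1]
    refine w.map_sum_lt one_ne_zero fun i _ => ?_
    rw [Valuation.map_neg, map_mul, map_pow, hu, one_pow, mul_one]
    exact h.exists_residue_approximation (hd i)
  by_contra! hcon
  refine hlt.not_ge ?_
  rw [(IsAlgClosed.splits q).eq_prod_roots, ← Polynomial.coe_eval₂RingHom, map_mul,
    map_multiset_prod, Multiset.map_map, map_mul, map_multiset_prod, Multiset.map_map,
    Polynomial.coe_eval₂RingHom, Polynomial.eval₂_C, RingHom.comp_apply,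
    h.valuation_C (Polynomial.leadingCoeff_ne_zero.2 hq), one_mul]
  refine Multiset.one_le_prod_of_one_le fun x hx => ?_
  obtain ⟨c, -, rfl⟩ := Multiset.mem_map.1 hx
  simpa using hcon c

theorem exists_closer [IsAlgClosed k] {y : L} (hy : y ≠ 0) {p : Polynomial (HahnSeries ℝ k)}
    (hp : p ≠ 0) (hpy : p.eval₂ ι y = 0) : ∃ c, w (y - ι c) < w y := by
  obtain ⟨c, hc, hyc⟩ := h.exists_valuation_eq hy hp hpy
  have hιc : ι c ≠ 0 := by simpa using hc
  have hwy : w y ≠ 0 := by simpa using hy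
  obtain ⟨b, hb⟩ := h.exists_residue (u := y / ι c) (by rw [map_div₀, hyc, div_self (hyc ▸ hwy)])
    (p := p.comp (Polynomial.C c * Polynomial.X))
    (mt (Polynomial.comp_C_mul_X_eq_zero_iff (mem_nonZeroDivisors_of_ne_zero hc)).1 hp) (by
      rw [Polynomial.eval₂_comp]
      simpa [mul_div_cancel₀ _ hιc] using hpy)
  refine ⟨HahnSeries.C b * c, ?_⟩
  have : y - ι (HahnSeries.C b * c) = (y / ι c - ι (HahnSeries.C b)) * ι c := by
    rw [map_mul]; field_simp
  rw [this, map_mul, ← hyc]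
  exact mul_lt_of_lt_one_left (zero_lt_iff.2 hwy) hb

/-- `exists_closer`, applied to the error of a best approximation, would improve the latter unless
the error is zero. -/
theorem mem_range_of_eval₂_eq_zero [IsAlgClosed k] {y : L} {p : Polynomial (HahnSeries ℝ k)}
    (hp : p ≠ 0) (hpy : p.eval₂ ι y = 0) : ∃ b, ι b = y := by
  obtain ⟨b, hb⟩ := h.exists_best_approximation y
  by_contra! hne
  obtain ⟨c, hc⟩ := h.exists_closer (y := y - ι b) (sub_ne_zero.2 (hne b).symm)
    (p := p.comp (Polynomial.X + Polynomial.C b))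
    (fun h0 => hp (Polynomial.taylor_injective b (h0.trans (map_zero _).symm))) (by
      rw [Polynomial.eval₂_comp]
      simpa using hpy)
  refine hc.not_ge ?_
  rw [sub_sub, ← map_add]
  exact hb (b + c)

end ExtendsHahn

end HahnField

/-- The valuation ring of the Hahn field. -/
noncomputable def hahnValuationSubring (k : Type*) [Field k] :
    ValuationSubring (HahnSeries ℝ k) where
  carrier := {x | 0 ≤ x.orderTop}
  zero_mem' := by simp
  one_mem' := by simp
  add_mem' {x y} hx hy := by
    rw [Set.mem_ofPred_eq] at *
    exact (le_min hx hy).trans HahnSeries.min_orderTop_le_orderTop_add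
  mul_mem' {x y} hx hy := by
    rw [Set.mem_ofPred_eq] at *
    rw [HahnSeries.orderTop_mul]
    exact add_nonneg hx hy
  neg_mem' {x} hx := by rwa [Set.mem_ofPred_eq, HahnSeries.orderTop_neg,
    ← Set.mem_ofPred_eq (p := fun x => 0 ≤ HahnSeries.orderTop x)]
  mem_or_inv_mem' x := by
    rcases eq_or_ne x 0 with rfl | hx
    · simp
    have h1 : x.orderTop + x⁻¹.orderTop = 0 := by
      rw [← HahnSeries.orderTop_mul, mul_inv_cancel₀ hx, HahnSeries.orderTop_one]
    rcases le_total 0 x.orderTop with h | h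
    · exact Or.inl h
    · refine Or.inr ?_
      rw [Set.mem_ofPred_eq, ← h1]
      exact add_le_of_nonpos_left h

theorem mem_hahnValuationSubring {k : Type*} [Field k] {x : HahnSeries ℝ k} :
    x ∈ hahnValuationSubring k ↔ 0 ≤ x.orderTop := Set.mem_ofPred_eq.to_iff

theorem valuation_hahn_le_iff {k : Type*} [Field k] (x y : HahnSeries ℝ k) :
    (hahnValuationSubring k).valuation x ≤ (hahnValuationSubring k).valuation y ↔
      y.orderTop ≤ x.orderTop := by
  rcases eq_or_ne y 0 with rfl | hy
  · simp [HahnSeries.orderTop_eq_top]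
  have h1 : 0 < (hahnValuationSubring k).valuation y := zero_lt_iff.2 (by simpa using hy)
  have h2 : x.orderTop = (x / y).orderTop + y.orderTop := by
    rw [← HahnSeries.orderTop_mul, div_mul_cancel₀ _ hy]
  rw [← div_le_one₀ h1, ← map_div₀, ValuationSubring.valuation_le_one_iff,
    mem_hahnValuationSubring, h2]
  obtain ⟨g, hg⟩ := WithTop.ne_top_iff_exists.1 (HahnSeries.orderTop_ne_top.2 hy)
  rw [← hg]
  exact (WithTop.add_le_add_iff_right (x := 0) WithTop.coe_ne_top |>.symm.trans (by rw [zero_add]))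

/-- Chevalley: a valuation ring dominating the local ring `i(A)` restricts to `A`. -/
theorem exists_extension {F L : Type*} [Field F] [Field L] (A : ValuationSubring F) (i : F →+* L) :
    ∃ O : ValuationSubring L, O.comap i = A := by
  obtain ⟨O, hO⟩ := (A.toLocalSubring.map i).exists_le_valuationSubring
  refine ⟨O, comap_eq_of_dominates A O i (fun a ha => hO.1 ⟨a, ha, rfl⟩) fun a ha => ?_⟩
  obtain ⟨ha', ha⟩ := ValuationSubring.mem_nonunits_iff_exists_mem_maximalIdeal.1 ha
  have hmem : i a ∈ (A.toLocalSubring.map i).toSubring := ⟨a, ha', rfl⟩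
  refine ValuationSubring.mem_nonunits_iff_exists_mem_maximalIdeal.2 ⟨hO.1 hmem, ?_⟩
  rw [IsLocalRing.mem_maximalIdeal, mem_nonunits_iff] at ha ⊢
  intro hu
  obtain ⟨⟨_, b, hb, rfl⟩, hc⟩ := (hO.2.1 ⟨i a, hmem⟩ hu).exists_right_inv
  refine ha (IsUnit.of_mul_eq_one ⟨b, hb⟩ (Subtype.ext (i.injective ?_)))
  exact (map_mul i a b).trans ((congrArg Subtype.val hc).trans (map_one i).symm)

theorem isAlgClosed_hahnSeries (k : Type*) [Field k] [IsAlgClosed k] :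
    IsAlgClosed (HahnSeries ℝ k) := by
  let ι := algebraMap (HahnSeries ℝ k) (AlgebraicClosure (HahnSeries ℝ k))
  obtain ⟨O, hO⟩ := exists_extension (hahnValuationSubring k) ι
  have h : ExtendsHahn O.valuation ι := fun x y =>
    (valuation_le_iff_of_comap_eq O _ ι hO x y).trans (valuation_hahn_le_iff x y)
  refine IsAlgClosed.of_exists_root _ fun p _ hp => ?_
  obtain ⟨y, hy⟩ := IsAlgClosed.exists_eval₂_eq_zero ι p hp.degree_pos.ne'
  obtain ⟨b, rfl⟩ := h.mem_range_of_eval₂_eq_zero hp.ne_zero hy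
  refine ⟨b, ι.injective ?_⟩
  rwa [map_zero, ← Polynomial.eval₂_at_apply]

/-- The hypotheses are first-order axioms on `D`, so they pass to elementarily equivalent
structures; the ring is `{x | D 1 x}`. -/
theorem exists_valuationSubring_of_div {N : Type*} [Field N] (D : N → N → Prop)
    (total : ∀ x y, D x y ∨ D y x) (trans : ∀ x y z, D x y → D y z → D x z)
    (mul : ∀ x y z, D x y → D (x * z) (y * z)) (add : ∀ x y z, D x y → D x z → D x (y + z))
    (zero_one : ¬ D 0 1) :
    ∃ O : ValuationSubring N, ∀ x y, D x y ↔ O.valuation y ≤ O.valuation x := by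
  have refl : ∀ x, D x x := fun x => (total x x).elim id id
  have mul_iff : ∀ x y z, z ≠ 0 → (D (x * z) (y * z) ↔ D x y) := fun x y z hz =>
    ⟨fun h => by simpa [hz] using mul _ _ z⁻¹ h, mul x y z⟩
  let O : ValuationSubring N :=
    { carrier := {x | D 1 x}
      zero_mem' := (total 1 0).resolve_right zero_one
      one_mem' := refl 1
      add_mem' := fun {x y} hx hy => add 1 x y hx hy
      mul_mem' := fun {x y} hx hy => trans 1 y (x * y) hy (by simpa using mul 1 x y hx)
      neg_mem' := fun {x} hx => by
        have h1 : D 1 (-1) := (total 1 (-1)).elim id fun h => by simpa using mul _ _ (-1) h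
        exact trans 1 x (-x) hx (by simpa using mul 1 (-1) x h1)
      mem_or_inv_mem' := fun x => by
        rcases eq_or_ne x 0 with rfl | hx
        · exact Or.inl ((total 1 0).resolve_right zero_one)
        · exact (total 1 x).imp id fun h => by
            have := mul _ _ x⁻¹ h
            rwa [mul_inv_cancel₀ hx, one_mul] at this }
  have hO : ∀ x, x ∈ O ↔ D 1 x := fun x => Iff.rfl
  refine ⟨O, fun x y => ?_⟩
  rcases eq_or_ne x 0 with rfl | hx
  · rw [map_zero, le_zero_iff, map_eq_zero]
    refine ⟨fun h => ?_, fun h => h ▸ refl 0⟩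
    by_contra hy
    refine zero_one ?_
    have := mul _ _ y⁻¹ h
    rwa [zero_mul, mul_inv_cancel₀ hy] at this
  · have hvx : 0 < O.valuation x := zero_lt_iff.2 (by simpa using hx)
    rw [← div_le_one₀ hvx, ← map_div₀, ValuationSubring.valuation_le_one_iff, hO,
      ← mul_iff 1 (y / x) x hx, one_mul, div_mul_cancel₀ _ hx]

/-! ### Models of the theory of an algebraically closed valued field. -/

section Transfer

open FirstOrder.Language FirstOrder.Ring

/-- The universal closure of a formula. -/
noncomputable def universalClosure {L : FirstOrder.Language.{0, 0}} {n : ℕ}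
    (φ : L.Formula (Fin n)) :
    L.Sentence :=
  Formula.iAlls (α := Empty) (Fin n) (φ.relabel (Sum.inr : Fin n → Empty ⊕ Fin n))

theorem realize_universalClosure {L : FirstOrder.Language.{0, 0}} {M : Type*} [L.Structure M]
    {n : ℕ}
    (φ : L.Formula (Fin n)) : M ⊨ universalClosure φ ↔ ∀ a : Fin n → M, φ.Realize a := by
  refine Formula.realize_iAlls.trans (forall_congr' fun a => ?_)
  rw [Formula.realize_relabel]
  rfl

theorem forall_realize_iff_of_model {L : FirstOrder.Language.{0, 0}} {K N : Type*} [L.Structure K]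
    [L.Structure N] [N ⊨ L.completeTheory K] {n : ℕ} (φ : L.Formula (Fin n)) :
    (∀ a : Fin n → N, φ.Realize a) ↔ ∀ a : Fin n → K, φ.Realize a := by
  rw [← realize_universalClosure, realize_iff_of_model_completeTheory K N, realize_universalClosure]

theorem exists_field_of_model {K N : Type*} [valuedFieldLanguage.Structure K]
    [valuedFieldLanguage.Structure N] [Field K] [IsAlgClosed K]
    (hK : ∀ {n : ℕ} (f : valuedFieldLanguage.Functions n) (x : Fin n → K),
      Language.Structure.funMap f x = funValue f x)
    [hN : N ⊨ valuedFieldLanguage.completeTheory K] :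
    ∃ _ : Field N, IsAlgClosed N ∧
      ∀ {n : ℕ} (f : valuedFieldLanguage.Functions n) (x : Fin n → N),
        Language.Structure.funMap f x = funValue f x := by
  let ι : Language.ring →ᴸ valuedFieldLanguage := LHom.sumInl
  let : CompatibleRing K :=
    { ι.reduct K with
      funMap_add := fun x => hK (Sum.inl addFunc : valuedFieldLanguage.Functions 2) x
      funMap_mul := fun x => hK (Sum.inl mulFunc : valuedFieldLanguage.Functions 2) x
      funMap_neg := fun x => hK (Sum.inl negFunc : valuedFieldLanguage.Functions 1) x
      funMap_zero := fun x => hK (Sum.inl zeroFunc : valuedFieldLanguage.Functions 0) x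
      funMap_one := fun x => hK (Sum.inl oneFunc : valuedFieldLanguage.Functions 0) x }
  let : Language.ring.Structure N := ι.reduct N
  have : CharP K (ringChar K) := ringChar.charP K
  have hexp : ι.IsExpansionOn K := ⟨fun _ _ => rfl, fun _ _ => rfl⟩
  have hexpN : ι.IsExpansionOn N := ⟨fun _ _ => rfl, fun _ _ => rfl⟩
  -- The field structure on `N` comes from the axioms of algebraically closed fields in the
  -- characteristic of `K`, read in the reduct to the language of rings.
  have hACF : N ⊨ Theory.ACF (ringChar K) := by
    refine (Theory.model_iff _).2 fun σ hσ => ?_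
    rw [← ι.realize_onSentence N, realize_iff_of_model_completeTheory K N, ι.realize_onSentence K]
    exact Theory.realize_sentence_of_mem (Theory.ACF (ringChar K)) hσ
  have := FirstOrder.Field.modelField_of_modelACF (ringChar K) N
  let : Field N := FirstOrder.Field.fieldOfModelField N
  let : CompatibleRing N := FirstOrder.Field.compatibleRingOfModelField N
  refine ⟨inferInstance, FirstOrder.Field.isAlgClosed_of_model_ACF (ringChar K) N,
    fun {n} f x => ?_⟩
  rcases f with f | f
  · rcases f with _ | _ | _ | _ | _
    · exact CompatibleRing.funMap_add x
    · exact CompatibleRing.funMap_mul x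
    · exact CompatibleRing.funMap_neg x
    · exact CompatibleRing.funMap_zero x
    · exact CompatibleRing.funMap_one x
  · exact f.elim

theorem exists_isACVF_of_model {K N : Type*} [valuedFieldLanguage.Structure K]
    [valuedFieldLanguage.Structure N] [Field K] {O : ValuationSubring K} (hK : IsACVF K O)
    [hN : N ⊨ valuedFieldLanguage.completeTheory K] :
    ∃ (_ : Field N) (A : ValuationSubring N), IsACVF N A := by
  have := hK.isAlgClosed
  obtain ⟨_, hAC, hfun⟩ := exists_field_of_model (K := K) (N := N) hK.funMap_eq
  let D : N → N → Prop := fun x y => Language.Structure.RelMap divRel ![x, y]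
  have hD : ∀ {n : ℕ} (s t : valuedFieldLanguage.Term (Fin n)) (a : Fin n → N),
      (divFormula s t).Realize a ↔ D (termValue a s) (termValue a t) := fun s t a => by
    rw [divFormula, Formula.realize_rel, ← realize_term hfun, ← realize_term hfun]
    refine iff_of_eq (congrArg _ (funext fun i => ?_))
    fin_cases i <;> rfl
  have hDK := fun {n : ℕ} (s t : valuedFieldLanguage.Term (Fin n)) (a : Fin n → K) =>
    hK.realize_divFormula s t a
  let x₀ : valuedFieldLanguage.Term (Fin 3) := .var 0
  let x₁ : valuedFieldLanguage.Term (Fin 3) := .var 1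
  let x₂ : valuedFieldLanguage.Term (Fin 3) := .var 2
  have total : ∀ x y, D x y ∨ D y x := fun x y => by
    have := (forall_realize_iff_of_model (K := K) (N := N) (divFormula x₀ x₁ ⊔ divFormula x₁ x₀)).2
      (fun a => by
        rw [Formula.realize_sup, hDK, hDK]
        exact le_total _ _) ![x, y, 0]
    rwa [Formula.realize_sup, hD, hD] at this
  have trans : ∀ x y z, D x y → D y z → D x z := fun x y z => by
    have := (forall_realize_iff_of_model (K := K) (N := N)
      ((divFormula x₀ x₁).imp ((divFormula x₁ x₂).imp (divFormula x₀ x₂)))).2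
      (fun a => by
        rw [Formula.realize_imp, Formula.realize_imp, hDK, hDK, hDK]
        exact fun h1 h2 => h2.trans h1) ![x, y, z]
    rwa [Formula.realize_imp, Formula.realize_imp, hD, hD, hD] at this
  have mul : ∀ x y z, D x y → D (x * z) (y * z) := fun x y z => by
    have := (forall_realize_iff_of_model (K := K) (N := N) ((divFormula x₀ x₁).imp
      (divFormula (ringTerm mulFunc ![x₀, x₂]) (ringTerm mulFunc ![x₁, x₂])))).2
      (fun a => by
        rw [Formula.realize_imp, hDK, hDK, termValue_mul, termValue_mul, map_mul, map_mul]
        exact fun h => mul_le_mul_left h _) ![x, y, z]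
    rwa [Formula.realize_imp, hD, hD] at this
  have add : ∀ x y z, D x y → D x z → D x (y + z) := fun x y z => by
    have := (forall_realize_iff_of_model (K := K) (N := N) ((divFormula x₀ x₁).imp
      ((divFormula x₀ x₂).imp (divFormula x₀ (ringTerm addFunc ![x₁, x₂]))))).2
      (fun a => by
        rw [Formula.realize_imp, Formula.realize_imp, hDK, hDK, hDK, termValue_add]
        exact fun h1 h2 => (O.valuation.map_add _ _).trans (max_le h1 h2)) ![x, y, z]
    rwa [Formula.realize_imp, Formula.realize_imp, hD, hD, hD] at this
  have zero_one : ¬ D 0 1 := by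
    have := (forall_realize_iff_of_model (K := K) (N := N)
      (divFormula (β := Fin 0) (ringTerm zeroFunc ![]) (ringTerm oneFunc ![])).not).2
      (fun a => by
        rw [Formula.realize_not, hDK, termValue_zero, termValue_one]
        simp) ![]
    rwa [Formula.realize_not, hD] at this
  obtain ⟨A, hA⟩ := exists_valuationSubring_of_div D total trans mul add zero_one
  refine ⟨_, A, ⟨⟨hfun, fun x => ?_⟩, hAC, ?_⟩⟩
  · rw [← hA]
    refine iff_of_eq (congrArg _ (funext fun i => ?_))
    fin_cases i <;> rfl
  · by_contra! hcon
    obtain ⟨x, hx, hx1⟩ := hK.nontrivial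
    -- Triviality of the valuation is a universal sentence, each `x` being 0 or of value at least 1,
    -- so it would descend from `N` to `K`.
    have := (forall_realize_iff_of_model (K := K) (N := N)
      ((divFormula x₀ (ringTerm oneFunc ![])) ⊔ (divFormula (ringTerm zeroFunc ![]) x₀))).1
      (fun a => by
        rw [Formula.realize_sup, hD, hD, termValue_one, termValue_zero, hA, hA, map_one, map_zero,
          le_zero_iff, map_eq_zero, or_iff_not_imp_right]
        exact hcon _) ![x, 0, 0]
    rw [Formula.realize_sup, hDK, hDK, termValue_one, termValue_zero, map_one, map_zero,
      le_zero_iff, map_eq_zero] at this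
    exact this.elim hx1.not_ge hx

end Transfer

theorem isACVF_hahnSeries (k : Type*) [Field k] [IsAlgClosed k] :
    IsACVF (HahnSeries ℝ k) (hahnValuationSubring k) := by
  refine ⟨⟨fun {n} f x => ?_, fun x => ?_⟩, isAlgClosed_hahnSeries k, HahnSeries.single 1 1, ?_, ?_⟩
  · rcases f with f | f
    · rfl
    · exact f.elim
  · rw [valuation_hahn_le_iff, ← HahnSeries.addVal_apply, ← HahnSeries.addVal_apply]
    rfl
  · exact HahnSeries.single_ne_zero one_ne_zero
  · rw [← map_one (hahnValuationSubring k).valuation, ← not_le, valuation_hahn_le_iff,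
      HahnSeries.orderTop_single one_ne_zero, HahnSeries.orderTop_one, not_le]
    exact_mod_cast one_pos

/-! ### Valuation independent families and cuts in the value group. -/

section Orthogonal

variable {k L Γ₀ : Type*} [Field k] [Field L] [LinearOrderedCommGroupWithZero Γ₀]

/-- The family `e` is valuation independent over the Hahn field. -/
def ValuationIndependent (w : Valuation L Γ₀) (ι : HahnSeries ℝ k →+* L) {N : ℕ} (e : Fin N → L) :
    Prop :=
  ∀ (a : Fin N → HahnSeries ℝ k) (j : Fin N), w (ι (a j) * e j) ≤ w (∑ i, ι (a i) * e i)

variable {w : Valuation L Γ₀} {ι : HahnSeries ℝ k →+* L}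

/-- Both sums have the value of their dominant terms, and comparing maxima is a condition of the
form "for all `i` there is `j`". -/
theorem ValuationIndependent.le_iff {N : ℕ} {e : Fin N → L} (he : ValuationIndependent w ι e)
    (a b : Fin N → HahnSeries ℝ k) :
    w (∑ i, ι (a i) * e i) ≤ w (∑ i, ι (b i) * e i) ↔
      ∀ i, ∃ j, w (ι (a i) * e i) ≤ w (ι (b j) * e j) := by
  refine ⟨fun h i => ?_, fun h => w.map_sum_le fun i _ => ?_⟩
  · obtain ⟨j, -, hj⟩ := Finset.exists_max_image Finset.univ (fun j => w (ι (b j) * e j))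
      ⟨i, Finset.mem_univ i⟩
    exact ⟨j, (he a i).trans (h.trans (w.map_sum_le fun l hl => hj l hl))⟩
  · obtain ⟨j, hj⟩ := h i
    exact hj.trans (he b j)

/-- Independence bounds each coordinate of a difference separately, so spherical completeness is
applied coordinate by coordinate, with radii rescaled by `w (e j)`. -/
theorem ExtendsHahn.exists_best_approximation_span (h : ExtendsHahn w ι) {N : ℕ} {e : Fin N → L}
    (he : ValuationIndependent w ι e) (y : L) :
    ∃ a₀ : Fin N → HahnSeries ℝ k, ∀ a : Fin N → HahnSeries ℝ k,
      w (y - ∑ i, ι (a₀ i) * e i) ≤ w (y - ∑ i, ι (a i) * e i) := by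
  have hsub : ∀ a a' : Fin N → HahnSeries ℝ k, ∑ i, ι (a i - a' i) * e i =
      (y - ∑ i, ι (a' i) * e i) - (y - ∑ i, ι (a i) * e i) := fun a a' => by
    simp only [map_sub, sub_mul, Finset.sum_sub_distrib]
    ring
  have key : ∀ j, ∃ c, ∀ a : Fin N → HahnSeries ℝ k,
      w (ι (c - a j) * e j) ≤ w (y - ∑ i, ι (a i) * e i) := by
    intro j
    rcases eq_or_ne (e j) 0 with hj | hj
    · exact ⟨0, fun a => by simp [hj]⟩
    have hj' : 0 < w (e j) := zero_lt_iff.2 (by simpa using hj)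
    obtain ⟨c, hc⟩ := h.exists_mem_balls (fun a : Fin N → HahnSeries ℝ k => a j)
      (fun a => w (y - ∑ i, ι (a i) * e i) / w (e j)) fun a a' => by
        rw [le_max_iff, le_div_iff₀ hj', le_div_iff₀ hj', ← le_max_iff, ← map_mul, max_comm]
        refine (he (fun i => a i - a' i) j).trans ?_
        rw [hsub]
        exact w.map_sub _ _
    refine ⟨c, fun a => ?_⟩
    rw [map_mul, ← le_div_iff₀ hj']
    exact hc a
  choose c hc using key
  refine ⟨c, fun a => ?_⟩
  have h1 : y - ∑ i, ι (c i) * e i = (y - ∑ i, ι (a i) * e i) - ∑ i, ι (c i - a i) * e i := by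
    rw [hsub]; ring
  rw [h1]
  exact (w.map_sub _ _).trans (max_le le_rfl (w.map_sum_le fun i _ => hc i a))

/-- Gram–Schmidt: the next vector is replaced by its error `z` from a best approximation in the
span. Minimality of `w z` says that adding elements of the span to a multiple of `z` never lowers
its value. Zero vectors are allowed in `e`. -/
theorem ExtendsHahn.exists_valuationIndependent (h : ExtendsHahn w ι) {N : ℕ} (b : Fin N → L) :
    ∃ (e : Fin N → L) (c : Fin N → Fin N → HahnSeries ℝ k), ValuationIndependent w ι e ∧
      ∀ i, b i = ∑ j, ι (c i j) * e j := by
  induction N with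
  | zero => exact ⟨b, fun i => i.elim0, fun _ j => j.elim0, fun i => i.elim0⟩
  | succ N ih =>
    obtain ⟨e, c, he, hb⟩ := ih (fun i => b i.castSucc)
    obtain ⟨a₀, ha₀⟩ := h.exists_best_approximation_span he (b (Fin.last N))
    obtain ⟨z, hz⟩ : ∃ z, z = b (Fin.last N) - ∑ i, ι (a₀ i) * e i := ⟨_, rfl⟩
    rw [← hz] at ha₀
    have hsnoc : ∀ a : Fin (N + 1) → HahnSeries ℝ k,
        ∑ i, ι (a i) * (Fin.snoc e z : Fin (N + 1) → L) i =
          ∑ i : Fin N, ι (a i.castSucc) * e i + ι (a (Fin.last N)) * z := fun a => by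
      simp [Fin.sum_univ_castSucc]
    refine ⟨Fin.snoc e z, Fin.lastCases (Fin.snoc a₀ 1) fun i => Fin.snoc (c i) 0, ?_, ?_⟩
    · intro a
      rw [hsnoc]
      have h1 : w (ι (a (Fin.last N)) * z) ≤
          w (∑ i : Fin N, ι (a i.castSucc) * e i + ι (a (Fin.last N)) * z) := by
        rcases eq_or_ne (a (Fin.last N)) 0 with h0 | h0
        · simp [h0]
        have hι : ι (a (Fin.last N)) ≠ 0 := by simpa using h0
        have h2 : ∑ i : Fin N, ι (a i.castSucc) * e i + ι (a (Fin.last N)) * z =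
            ι (a (Fin.last N)) * (b (Fin.last N) -
              ∑ i, ι (a₀ i - a i.castSucc / a (Fin.last N)) * e i) := by
          have h3 : ∀ i, ι (a₀ i - a i.castSucc / a (Fin.last N)) * e i =
              ι (a₀ i) * e i - (ι (a (Fin.last N)))⁻¹ * (ι (a i.castSucc) * e i) := fun i => by
            rw [map_sub, map_div₀]; ring
          simp only [h3, Finset.sum_sub_distrib, ← Finset.mul_sum, hz]
          field_simp
          ring
        rw [h2, map_mul, map_mul]
        exact mul_le_mul_right (ha₀ _) _
      refine Fin.lastCases ?_ fun j => ?_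
      · simpa using h1
      · have h2 := w.map_sub (∑ i : Fin N, ι (a i.castSucc) * e i + ι (a (Fin.last N)) * z)
          (ι (a (Fin.last N)) * z)
        rw [add_sub_cancel_right, max_eq_left h1] at h2
        have h3 := he (fun i => a i.castSucc) j
        simpa using h3.trans h2
    · refine Fin.lastCases ?_ fun i => ?_
      · rw [hsnoc]
        simp [hz]
      · rw [hsnoc]
        simp [hb]

/-- The propositions encode the possible shapes: `P₁` for `u = 0`, `P₂` for all of `ℝ`, `P₃` and
`P₄` for a closed and an open ray with endpoint the order of `c`; none holds for the empty set or
`u' = 0` with `u ≠ 0`. -/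
theorem ExtendsHahn.exists_cut (h : ExtendsHahn w ι) (u u' : L) :
    ∃ (P₁ P₂ P₃ P₄ : Prop) (c : HahnSeries ℝ k), ∀ y y' : HahnSeries ℝ k,
      w (ι y * u) ≤ w (ι y' * u') ↔ y = 0 ∨ P₁ ∨ (P₂ ∧ y' ≠ 0) ∨
        (P₃ ∧ y'.orderTop + c.orderTop ≤ y.orderTop) ∨
        (P₄ ∧ y'.orderTop + c.orderTop < y.orderTop) := by
  rcases eq_or_ne u 0 with rfl | hu
  · exact ⟨True, False, False, False, 0, fun y y' => by simp⟩
  rcases eq_or_ne u' 0 with rfl | hu'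
  · exact ⟨False, False, False, False, 0, fun y y' => by simp [hu]⟩
  have hwu : 0 < w u := zero_lt_iff.2 (by simpa using hu)
  have hwu' : 0 < w u' := zero_lt_iff.2 (by simpa using hu')
  -- The upward closed set of exponents that decides the comparison; its infimum is the only
  -- parameter needed.
  let E : Set ℝ := {r | w (ι (HahnSeries.single r 1)) * w u ≤ w u'}
  have hE : ∀ r s, r ∈ E → r ≤ s → s ∈ E := fun r s hr hrs =>
    (mul_le_mul_left (h.single_le_single.2 hrs) _).trans hr
  have key : ∀ y y' : HahnSeries ℝ k, y ≠ 0 → y' ≠ 0 →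
      (w (ι y * u) ≤ w (ι y' * u') ↔ y.order - y'.order ∈ E) := by
    intro y y' hy hy'
    have hwy' : 0 < w (ι y') := zero_lt_iff.2 (by simpa using hy')
    have h1 : y.order - y'.order = (y / y').order := by
      rw [sub_eq_iff_eq_add, ← HahnSeries.order_mul (div_ne_zero hy hy') hy', div_mul_cancel₀ _ hy']
    have h2 : y.order - y'.order ∈ E ↔ w (ι (y / y')) * w u ≤ w u' := by
      rw [h.eq_single (div_ne_zero hy hy'), ← h1]
      exact Iff.rfl
    rw [h2, map_div₀, map_div₀, map_mul, map_mul, div_mul_eq_mul_div, div_le_iff₀' hwy']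
  have hzero : ∀ y : HahnSeries ℝ k, y ≠ 0 → ¬ w (ι y * u) ≤ w (ι 0 * u') := by
    intro y hy hle
    simp [hy, hu] at hle
  have htop : ∀ y y' : HahnSeries ℝ k, ∀ s : ℝ, y ≠ 0 → y' ≠ 0 →
      (y'.orderTop + (HahnSeries.single s (1 : k)).orderTop ≤ y.orderTop ↔ s ≤ y.order - y'.order) ∧
      (y'.orderTop + (HahnSeries.single s (1 : k)).orderTop < y.orderTop ↔
        s < y.order - y'.order) := by
    intro y y' s hy hy'
    rw [HahnSeries.orderTop_single one_ne_zero, ← HahnSeries.order_eq_orderTop_of_ne_zero hy,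
      ← HahnSeries.order_eq_orderTop_of_ne_zero hy', ← WithTop.coe_add, WithTop.coe_le_coe,
      WithTop.coe_lt_coe, add_comm, le_sub_iff_add_le, lt_sub_iff_add_lt]
    exact ⟨Iff.rfl, Iff.rfl⟩
  by_cases hall : ∀ r, r ∈ E
  · refine ⟨False, True, False, False, 0, fun y y' => ?_⟩
    rcases eq_or_ne y 0 with rfl | hy
    · simp
    rcases eq_or_ne y' 0 with rfl | hy'
    · exact iff_of_false (hzero y hy) (by simp [hy])
    · exact iff_of_true ((key y y' hy hy').2 (hall _)) (by simp [hy'])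
  by_cases hnone : ∀ r, r ∉ E
  · refine ⟨False, False, False, False, 0, fun y y' => ?_⟩
    rcases eq_or_ne y 0 with rfl | hy
    · simp
    rcases eq_or_ne y' 0 with rfl | hy'
    · exact iff_of_false (hzero y hy) (by simp [hy])
    · exact iff_of_false (mt (key y y' hy hy').1 (hnone _)) (by simp [hy])
  push Not at hall hnone
  obtain ⟨r₀, hr₀⟩ := hall
  obtain ⟨r₁, hr₁⟩ := hnone
  have hbdd : BddBelow E := ⟨r₀, fun r hr => le_of_not_gt fun hlt => hr₀ (hE r r₀ hr hlt.le)⟩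
  have hglb := isGLB_csInf ⟨r₁, hr₁⟩ hbdd
  by_cases hs : sInf E ∈ E
  · refine ⟨False, False, True, False, HahnSeries.single (sInf E) 1, fun y y' => ?_⟩
    rcases eq_or_ne y 0 with rfl | hy
    · simp
    rcases eq_or_ne y' 0 with rfl | hy'
    · exact iff_of_false (hzero y hy) (by simp [hy])
    · rw [key y y' hy hy', (htop y y' _ hy hy').1]
      simp only [hy, false_or, true_and, false_and, or_false]
      exact ⟨fun hr => hglb.1 hr, fun hr => hE _ _ hs hr⟩
  · refine ⟨False, False, False, True, HahnSeries.single (sInf E) 1, fun y y' => ?_⟩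
    rcases eq_or_ne y 0 with rfl | hy
    · simp
    rcases eq_or_ne y' 0 with rfl | hy'
    · exact iff_of_false (hzero y hy) (by simp [hy])
    · rw [key y y' hy hy', (htop y y' _ hy hy').2]
      simp only [hy, false_or, true_and, false_and]
      refine ⟨fun hr => lt_of_le_of_ne (hglb.1 hr) fun heq => hs (heq ▸ hr), fun hr => ?_⟩
      obtain ⟨r, hrE, hr'⟩ := (isGLB_lt_iff hglb).1 hr
      exact hE _ _ hrE hr'.le

end Orthogonal

/-! ### Calculus of uniformly definable families. -/

section UniformDefinability

open FirstOrder.Language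

/-- The sets of `m`-tuples in the family `S` are defined by one formula, with parameters. -/
def UniformlyDefinable (L : FirstOrder.Language.{0, 0}) {K : Type u} [L.Structure K] {I : Type w}
    {m : ℕ} (S : I → (Fin m → K) → Prop) : Prop :=
  ∃ (β : Type) (_ : Finite β) (χ : L.Formula (Fin m ⊕ β)), ∀ i, ∃ a : β → K, ∀ x,
    S i x ↔ χ.Realize (Sum.elim x a)

namespace UniformlyDefinable

variable {L : FirstOrder.Language.{0, 0}} {K : Type u} [L.Structure K] {I : Type w} {m : ℕ}
  {S S' : I → (Fin m → K) → Prop}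

theorem congr (hS : UniformlyDefinable L S) (h : ∀ i x, S' i x ↔ S i x) :
    UniformlyDefinable L S' := by
  obtain ⟨β, hβ, χ, hχ⟩ := hS
  refine ⟨β, hβ, χ, fun i => ?_⟩
  obtain ⟨a, ha⟩ := hχ i
  exact ⟨a, fun x => (h i x).trans (ha x)⟩

theorem not (hS : UniformlyDefinable L S) : UniformlyDefinable L fun i x => ¬ S i x := by
  obtain ⟨β, hβ, χ, hχ⟩ := hS
  refine ⟨β, hβ, χ.not, fun i => ?_⟩
  obtain ⟨a, ha⟩ := hχ i
  exact ⟨a, fun x => (not_congr (ha x)).trans Formula.realize_not.symm⟩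

theorem and (hS : UniformlyDefinable L S) (hS' : UniformlyDefinable L S') :
    UniformlyDefinable L fun i x => S i x ∧ S' i x := by
  obtain ⟨β, hβ, χ, hχ⟩ := hS
  obtain ⟨β', hβ', χ', hχ'⟩ := hS'
  refine ⟨β ⊕ β', inferInstance, χ.relabel (Sum.map id Sum.inl) ⊓ χ'.relabel (Sum.map id Sum.inr),
    fun i => ?_⟩
  obtain ⟨a, ha⟩ := hχ i
  obtain ⟨a', ha'⟩ := hχ' i
  refine ⟨Sum.elim a a', fun x => ?_⟩
  rw [Formula.realize_inf, Formula.realize_relabel, Formula.realize_relabel, Sum.elim_comp_map,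
    Sum.elim_comp_map, Function.comp_id, Sum.elim_comp_inl, Sum.elim_comp_inr]
  exact and_congr (ha x) (ha' x)

theorem or (hS : UniformlyDefinable L S) (hS' : UniformlyDefinable L S') :
    UniformlyDefinable L fun i x => S i x ∨ S' i x :=
  (hS.not.and hS'.not).not.congr fun _ _ => by tauto

theorem imp (hS : UniformlyDefinable L S) (hS' : UniformlyDefinable L S') :
    UniformlyDefinable L fun i x => S i x → S' i x :=
  (hS.and hS'.not).not.congr fun _ _ => by tauto

theorem const [Nontrivial K] (P : I → Prop) :
    UniformlyDefinable L fun (i : I) (_ : Fin m → K) => P i := by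
  classical
  obtain ⟨c, d, hcd⟩ := exists_pair_ne K
  refine ⟨Fin 2, inferInstance,
    -- A truth value depending on `i` is encoded by whether two parameters are equal.
    Term.equal (L.var (Sum.inr 0 : Fin m ⊕ Fin 2)) (L.var (Sum.inr 1)),
    fun i => ⟨![c, if P i then c else d], fun x => ?_⟩⟩
  rw [Formula.realize_equal]
  by_cases h : P i
  · simp [h]
  · simp [h, hcd]

theorem forall_mem [Nontrivial K] {J : Type*} (s : Finset J) {S : J → I → (Fin m → K) → Prop}
    (hS : ∀ j, UniformlyDefinable L (S j)) : UniformlyDefinable L fun i x => ∀ j ∈ s, S j i x := by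
  classical
  induction s using Finset.induction_on with
  | empty => exact (const fun _ => True).congr fun i x => by simp
  | insert j s _ ih => exact ((hS j).and ih).congr fun i x => by simp

theorem forall_fintype [Nontrivial K] {J : Type*} [Fintype J] {S : J → I → (Fin m → K) → Prop}
    (hS : ∀ j, UniformlyDefinable L (S j)) : UniformlyDefinable L fun i x => ∀ j, S j i x :=
  (forall_mem Finset.univ hS).congr fun i x => by simp

theorem exists_fintype [Nontrivial K] {J : Type*} [Fintype J] {S : J → I → (Fin m → K) → Prop}
    (hS : ∀ j, UniformlyDefinable L (S j)) : UniformlyDefinable L fun i x => ∃ j, S j i x :=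
  (forall_fintype fun j => (hS j).not).not.congr fun i x => by simp

end UniformlyDefinable

/-- The functions in the family `Y` are given by one term, with parameters. -/
def UniformTerm {K : Type u} [CommRing K] {I : Type w} {m : ℕ} (Y : I → (Fin m → K) → K) : Prop :=
  ∃ (β : Type) (_ : Finite β) (t : valuedFieldLanguage.Term (Fin m ⊕ β)), ∀ i, ∃ a : β → K, ∀ x,
    Y i x = termValue (Sum.elim x a) t

theorem termValue_relabel {R β γ : Type*} [CommRing R] (ρ : γ → R) (g : β → γ)
    (t : valuedFieldLanguage.Term β) : termValue ρ (t.relabel g) = termValue (ρ ∘ g) t := by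
  induction t with
  | var i => rfl
  | func f ts ih =>
    rw [Term.relabel, termValue, termValue]
    exact congrArg (funValue f) (funext ih)

namespace UniformTerm

variable {K : Type u} [CommRing K] {I : Type w} {m : ℕ} {Y Z : I → (Fin m → K) → K}

theorem of_term (t : valuedFieldLanguage.Term (Fin m)) :
    UniformTerm fun (_ : I) (x : Fin m → K) => termValue x t :=
  ⟨Fin 0, inferInstance, t.relabel Sum.inl, fun _ => ⟨Fin.elim0, fun x => by
    rw [termValue_relabel, Sum.elim_comp_inl]⟩⟩

theorem const (c : I → K) : UniformTerm fun (i : I) (_ : Fin m → K) => c i :=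
  ⟨Fin 1, inferInstance, .var (Sum.inr 0), fun i => ⟨fun _ => c i, fun _ => rfl⟩⟩

theorem op (f : FirstOrder.Language.ring.Functions 2) (hY : UniformTerm Y) (hZ : UniformTerm Z) :
    UniformTerm fun i x =>
      funValue (Sum.inl f : valuedFieldLanguage.Functions 2) ![Y i x, Z i x] := by
  obtain ⟨β, hβ, t, ht⟩ := hY
  obtain ⟨β', hβ', t', ht'⟩ := hZ
  refine ⟨β ⊕ β', inferInstance,
    ringTerm f ![t.relabel (Sum.map id Sum.inl), t'.relabel (Sum.map id Sum.inr)], fun i => ?_⟩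
  obtain ⟨a, ha⟩ := ht i
  obtain ⟨a', ha'⟩ := ht' i
  refine ⟨Sum.elim a a', fun x => ?_⟩
  refine congrArg (funValue _) (funext fun j => ?_)
  fin_cases j
  · refine (ha x).trans (Eq.symm ((termValue_relabel _ (Sum.map id Sum.inl) t).trans ?_))
    rw [Sum.elim_comp_map, Function.comp_id, Sum.elim_comp_inl]
  · refine (ha' x).trans (Eq.symm ((termValue_relabel _ (Sum.map id Sum.inr) t').trans ?_))
    rw [Sum.elim_comp_map, Function.comp_id, Sum.elim_comp_inr]

theorem add (hY : UniformTerm Y) (hZ : UniformTerm Z) : UniformTerm fun i x => Y i x + Z i x :=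
  op FirstOrder.Ring.addFunc hY hZ

theorem mul (hY : UniformTerm Y) (hZ : UniformTerm Z) : UniformTerm fun i x => Y i x * Z i x :=
  op FirstOrder.Ring.mulFunc hY hZ

theorem sum {J : Type*} (s : Finset J) {Y : J → I → (Fin m → K) → K}
    (hY : ∀ j, UniformTerm (Y j)) : UniformTerm fun i x => ∑ j ∈ s, Y j i x := by
  classical
  induction s using Finset.induction_on with
  | empty => simpa using const (m := m) fun _ : I => (0 : K)
  | insert j s hj ih => simpa [Finset.sum_insert hj] using (hY j).add ih

end UniformTerm

theorem UniformTerm.uniformlyDefinable {K : Type u} [valuedFieldLanguage.Structure K] [Field K]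
    {O : ValuationSubring K} (hK : IsValuedField K O) {I : Type w} {m : ℕ}
    {Y Z : I → (Fin m → K) → K} (hY : UniformTerm Y) (hZ : UniformTerm Z) :
    UniformlyDefinable valuedFieldLanguage fun i x =>
      O.valuation (Y i x) ≤ O.valuation (Z i x) := by
  obtain ⟨β, hβ, t, ht⟩ := hY
  obtain ⟨β', hβ', t', ht'⟩ := hZ
  refine ⟨β ⊕ β', inferInstance,
    divFormula (t'.relabel (Sum.map id Sum.inr)) (t.relabel (Sum.map id Sum.inl)), fun i => ?_⟩
  obtain ⟨a, ha⟩ := ht i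
  obtain ⟨a', ha'⟩ := ht' i
  refine ⟨Sum.elim a a', fun x => ?_⟩
  rw [hK.realize_divFormula, termValue_relabel, termValue_relabel, Sum.elim_comp_map,
    Sum.elim_comp_map, Function.comp_id, Sum.elim_comp_inl, Sum.elim_comp_inr, ← ha, ← ha']

/-- Separates the variables ranging over the Hahn field from those ranging over the extension; the
index set depends only on the term. -/
theorem exists_bilinear_decomposition {α β : Type*} (t : valuedFieldLanguage.Term (α ⊕ β)) :
    ∃ (J : Type) (_ : Fintype J) (p : J → valuedFieldLanguage.Term α)
      (q : J → valuedFieldLanguage.Term β), ∀ (R : Type u) [CommRing R] (x : α → R) (b : β → R),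
        termValue (Sum.elim x b) t = ∑ j, termValue x (p j) * termValue b (q j) := by
  induction t with
  | var i =>
    rcases i with i | i
    · refine ⟨Unit, inferInstance, fun _ => .var i, fun _ => ringTerm Ring.oneFunc ![], ?_⟩
      intro R _ x b
      simp [termValue_one, termValue]
    · refine ⟨Unit, inferInstance, fun _ => ringTerm Ring.oneFunc ![], fun _ => .var i, ?_⟩
      intro R _ x b
      simp [termValue_one, termValue]
  | func f ts ih =>
    rcases f with f | f
    · rcases f with _ | _ | _ | _ | _
      · obtain ⟨J, _, p, q, h⟩ := ih 0
        obtain ⟨J', _, p', q', h'⟩ := ih 1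
        refine ⟨J ⊕ J', inferInstance, Sum.elim p p', Sum.elim q q', fun R _ x b => ?_⟩
        rw [Fintype.sum_sum_type]
        exact congrArg₂ (· + ·) (h R x b) (h' R x b)
      · obtain ⟨J, _, p, q, h⟩ := ih 0
        obtain ⟨J', _, p', q', h'⟩ := ih 1
        refine ⟨J × J', inferInstance, fun j => ringTerm Ring.mulFunc ![p j.1, p' j.2],
          fun j => ringTerm Ring.mulFunc ![q j.1, q' j.2], fun R _ x b => ?_⟩
        refine (congrArg₂ (· * ·) (h R x b) (h' R x b)).trans ?_
        simp only [termValue_mul, Fintype.sum_prod_type, Finset.sum_mul_sum]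
        exact Finset.sum_congr rfl fun j _ => Finset.sum_congr rfl fun j' _ => by ring
      · obtain ⟨J, _, p, q, h⟩ := ih 0
        refine ⟨J, inferInstance, fun j => ringTerm Ring.negFunc ![p j], q, fun R _ x b => ?_⟩
        refine (congrArg (- ·) (h R x b)).trans ?_
        simp only [termValue_neg, neg_mul, Finset.sum_neg_distrib]
      · exact ⟨Empty, inferInstance, Empty.elim, Empty.elim, fun R _ x b => by
          rw [Finset.univ_eq_empty, Finset.sum_empty]; rfl⟩
      · refine ⟨Unit, inferInstance, fun _ => ringTerm Ring.oneFunc ![],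
          fun _ => ringTerm Ring.oneFunc ![], fun R _ x b => ?_⟩
        simp only [termValue_one, mul_one, Finset.univ_unique, Finset.sum_singleton]
        rfl
    · exact f.elim

end UniformDefinability

/-! ### Traces of quantifier-free formulas on the Hahn field. -/

section StableEmbedding

variable {k : Type u} [Field k] [IsAlgClosed k] {M : Type w} [Field M] {A : ValuationSubring M}
  {ι : HahnSeries ℝ k →+* M} (h : ExtendsHahn A.valuation ι)

include h

theorem uniformlyDefinable_cut {I : Type*} {m : ℕ}
    {Y Z : I → (Fin m → HahnSeries ℝ k) → HahnSeries ℝ k}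
    (hY : UniformTerm Y) (hZ : UniformTerm Z) (u u' : I → M) :
    UniformlyDefinable valuedFieldLanguage fun i x =>
      A.valuation (ι (Y i x) * u i) ≤ A.valuation (ι (Z i x) * u' i) := by
  choose P₁ P₂ P₃ P₄ c hc using fun i => h.exists_cut (u i) (u' i)
  have hK := (isACVF_hahnSeries k).toIsValuedField
  have hle : ∀ {Y Z : I → (Fin m → HahnSeries ℝ k) → HahnSeries ℝ k}, UniformTerm Y →
      UniformTerm Z → UniformlyDefinable valuedFieldLanguage fun i x =>
        (Z i x).orderTop ≤ (Y i x).orderTop := fun hY hZ =>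
    (hY.uniformlyDefinable hK hZ).congr fun i x => (valuation_hahn_le_iff _ _).symm
  have hzero : ∀ {Y : I → (Fin m → HahnSeries ℝ k) → HahnSeries ℝ k}, UniformTerm Y →
      UniformlyDefinable valuedFieldLanguage fun i x => Y i x = 0 := fun hY =>
    (hle hY (UniformTerm.const fun _ => 0)).congr fun i x => by simp
  have hcZ := hZ.mul (UniformTerm.const c)
  refine UniformlyDefinable.congr ((hzero hY).or ((UniformlyDefinable.const P₁).or
    (((UniformlyDefinable.const P₂).and (hzero hZ).not).or
      (((UniformlyDefinable.const P₃).and (hle hY hcZ)).or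
        ((UniformlyDefinable.const P₄).and (hle hcZ hY).not))))) fun i x => ?_
  rw [hc, HahnSeries.orderTop_mul, not_le]

/-- The heart of the proof. One valuation independent family, depending on `b` alone, serves the
`q`-factors of both terms; in its coordinates the comparison splits into finitely many cuts between
polynomials in `x`. -/
theorem uniformlyDefinable_valuation_le {m n : ℕ} (s t : valuedFieldLanguage.Term (Fin m ⊕ Fin n)) :
    UniformlyDefinable valuedFieldLanguage fun (b : Fin n → M) (x : Fin m → HahnSeries ℝ k) =>
      A.valuation (termValue (Sum.elim (ι ∘ x) b) s) ≤
        A.valuation (termValue (Sum.elim (ι ∘ x) b) t) := by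
  obtain ⟨J, _, p, q, hs⟩ := exists_bilinear_decomposition.{w} s
  obtain ⟨J', _, p', q', ht⟩ := exists_bilinear_decomposition.{w} t
  let N := Fintype.card (J ⊕ J')
  let E : J ⊕ J' ≃ Fin N := Fintype.equivFin _
  choose e c he hc using fun b : Fin n → M => h.exists_valuationIndependent
    fun i : Fin N => Sum.elim (fun j => termValue b (q j)) (fun j => termValue b (q' j)) (E.symm i)
  have hq : ∀ b j, termValue b (q j) = ∑ i, ι (c b (E (Sum.inl j)) i) * e b i := fun b j => by
    rw [← hc]; simp
  have hq' : ∀ b j, termValue b (q' j) = ∑ i, ι (c b (E (Sum.inr j)) i) * e b i := fun b j => by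
    rw [← hc]; simp
  let Y : Fin N → (Fin n → M) → (Fin m → HahnSeries ℝ k) → HahnSeries ℝ k := fun i b x =>
    ∑ j, termValue x (p j) * c b (E (Sum.inl j)) i
  let Z : Fin N → (Fin n → M) → (Fin m → HahnSeries ℝ k) → HahnSeries ℝ k := fun i b x =>
    ∑ j, termValue x (p' j) * c b (E (Sum.inr j)) i
  have hY : ∀ i, UniformTerm (Y i) := fun i => UniformTerm.sum _ fun j =>
    (UniformTerm.of_term (p j)).mul (UniformTerm.const fun b => c b (E (Sum.inl j)) i)
  have hZ : ∀ i, UniformTerm (Z i) := fun i => UniformTerm.sum _ fun j =>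
    (UniformTerm.of_term (p' j)).mul (UniformTerm.const fun b => c b (E (Sum.inr j)) i)
  have hsY : ∀ b x, termValue (Sum.elim (ι ∘ x) b) s = ∑ i, ι (Y i b x) * e b i := fun b x => by
    simp only [hs, hq, Y, map_sum, map_mul, map_termValue, Finset.sum_mul, Finset.mul_sum]
    rw [Finset.sum_comm]
    exact Finset.sum_congr rfl fun i _ => Finset.sum_congr rfl fun j _ => (mul_assoc _ _ _).symm
  have htZ : ∀ b x, termValue (Sum.elim (ι ∘ x) b) t = ∑ i, ι (Z i b x) * e b i := fun b x => by
    simp only [ht, hq', Z, map_sum, map_mul, map_termValue, Finset.sum_mul, Finset.mul_sum]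
    rw [Finset.sum_comm]
    exact Finset.sum_congr rfl fun i _ => Finset.sum_congr rfl fun j _ => (mul_assoc _ _ _).symm
  refine UniformlyDefinable.congr (UniformlyDefinable.forall_fintype fun i =>
    UniformlyDefinable.exists_fintype fun j =>
      uniformlyDefinable_cut h (hY i) (hZ j) (fun b => e b i) fun b => e b j) fun b x => ?_
  rw [hsY, htZ, (he b).le_iff]

theorem uniformlyDefinable_of_isQF [valuedFieldLanguage.Structure M] (hM : IsValuedField M A)
    {m n : ℕ} (θ : valuedFieldLanguage.Formula (Fin m ⊕ Fin n))
    (hθ : Language.BoundedFormula.IsQF θ) :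
    UniformlyDefinable valuedFieldLanguage fun (b : Fin n → M) (x : Fin m → HahnSeries ℝ k) =>
      θ.Realize (Sum.elim (ι ∘ x) b) := by
  let r : (Fin m ⊕ Fin n) ⊕ Fin 0 → Fin m ⊕ Fin n := Sum.elim id Fin.elim0
  have hr : ∀ (t : valuedFieldLanguage.Term ((Fin m ⊕ Fin n) ⊕ Fin 0)) (a : Fin m ⊕ Fin n → M),
      t.realize (Sum.elim a default) = termValue a (t.relabel r) := fun t a => by
    rw [realize_term hM.funMap_eq, termValue_relabel]
    congr 1
    ext (i | i)
    · rfl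
    · exact i.elim0
  simp only [Language.Formula.Realize]
  induction hθ with
  | falsum => exact (UniformlyDefinable.const fun _ => False).congr fun _ _ => Iff.rfl
  | of_isAtomic hat =>
    rcases hat with ⟨t₁, t₂⟩ | ⟨R, ts⟩
    · refine (uniformlyDefinable_valuation_le h
        (ringTerm Ring.addFunc ![t₁.relabel r, ringTerm Ring.negFunc ![t₂.relabel r] ])
        (ringTerm Ring.zeroFunc ![])).congr fun b x => ?_
      rw [Language.BoundedFormula.realize_bdEqual, hr, hr, termValue_add, termValue_neg,
        termValue_zero, map_zero, le_zero_iff, map_eq_zero, ← sub_eq_add_neg, sub_eq_zero]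
    · obtain ⟨rfl, rfl⟩ := eq_divRel R
      refine (uniformlyDefinable_valuation_le h ((ts 1).relabel r) ((ts 0).relabel r)).congr
        fun b x => ?_
      rw [Language.BoundedFormula.realize_rel, hM.relMap_iff, hr, hr]
  | imp _ _ ih₁ ih₂ => exact (ih₁.imp ih₂).congr fun b x => Language.BoundedFormula.realize_imp

end StableEmbedding

/-- The ring homomorphism underlying an elementary embedding of valued fields. -/
def ringHomOfElementaryEmbedding {K M : Type*} [valuedFieldLanguage.Structure K]
    [valuedFieldLanguage.Structure M] [Field K] [Field M] {O : ValuationSubring K}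
    {A : ValuationSubring M} (hK : IsValuedField K O) (hM : IsValuedField M A)
    (f : K ↪ₑ[valuedFieldLanguage] M) : K →+* M :=
  have hf : ∀ {n : ℕ} (g : valuedFieldLanguage.Functions n) (x : Fin n → K),
      f (funValue g x) = funValue g (f ∘ x) := fun g x => by
    rw [← hK.funMap_eq, ← hM.funMap_eq]
    exact f.map_fun g x
  { toFun := f
    map_one' := hf (Sum.inl Ring.oneFunc : valuedFieldLanguage.Functions 0) ![]
    map_zero' := hf (Sum.inl Ring.zeroFunc : valuedFieldLanguage.Functions 0) ![]
    map_mul' := fun x y => hf (Sum.inl Ring.mulFunc : valuedFieldLanguage.Functions 2) ![x, y]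
    map_add' := fun x y => hf (Sum.inl Ring.addFunc : valuedFieldLanguage.Functions 2) ![x, y] }

/-- The defining formula is obtained inside the Hahn field; elementarity of `f` carries it to `M`.
-/
theorem uniformlyStablyEmbedded_range (k : Type u) [Field k] [IsAlgClosed k]
    (M : Type w) [valuedFieldLanguage.Structure M] (f : HahnSeries ℝ k ↪ₑ[valuedFieldLanguage] M) :
    UniformlyStablyEmbedded valuedFieldLanguage (Set.range f) := by
  have hK := isACVF_hahnSeries k
  have hT : M ⊨ valuedFieldLanguage.completeTheory (HahnSeries ℝ k) :=
    f.elementarilyEquivalent.completeTheory_eq ▸ inferInstance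
  obtain ⟨_, A, hM⟩ := exists_isACVF_of_model (N := M) hK
  let ι := ringHomOfElementaryEmbedding hK.toIsValuedField hM.toIsValuedField f
  have hι : ExtendsHahn A.valuation ι := fun x y => by
    rw [← valuation_hahn_le_iff]
    have h1 := hK.relMap_iff ![y, x]
    have h2 := hM.relMap_iff (f ∘ ![y, x])
    rw [f.map_rel] at h2
    exact h2.symm.trans h1
  intro m n φ
  obtain ⟨θ, hθ, hφθ⟩ := exists_isQF_iff_of_isACVF
    (T := valuedFieldLanguage.completeTheory (HahnSeries ℝ k))
    (fun N => exists_isACVF_of_model (N := N) hK) φ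
  obtain ⟨β, _, χ, hχ⟩ := uniformlyDefinable_of_isQF hι hM.toIsValuedField θ hθ
  let e : β ≃ Fin (Nat.card β) := Finite.equivFin β
  have : Nonempty M := ⟨0⟩
  refine ⟨Nat.card β, χ.relabel (Sum.map id e), fun b => ?_⟩
  obtain ⟨a, ha⟩ := hχ b
  refine ⟨f ∘ a ∘ e.symm, fun i => ⟨_, rfl⟩, Set.ext fun y => and_congr_right fun hy => ?_⟩
  choose x hx using hy
  obtain rfl : f ∘ x = y := funext hx
  have h1 : φ.Realize (Sum.elim (f ∘ x) b) ↔ θ.Realize (Sum.elim (f ∘ x) b) default :=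
    Language.BoundedFormula.realize_iff.1 (hφθ.realize_boundedFormula M)
  have h2 : Sum.elim (f ∘ x) (f ∘ a ∘ e.symm) ∘ Sum.map id e = f ∘ Sum.elim x a := by
    ext (i | i) <;> simp
  rw [h1, Language.Formula.realize_relabel, h2, f.map_formula]
  exact ha x

end HahnStableEmbedding

/-- For every algebraically closed field `k`, the Hahn field `k((t^ℝ))` is uniformly stably
embedded, as a valued field, in each of its elementary extensions. -/
theorem mainTheorem12 (k : Type u) [Field k] [IsAlgClosed k]
    (M : Type w) [HahnStableEmbedding.valuedFieldLanguage.Structure M]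
    (f : HahnSeries ℝ k ↪ₑ[HahnStableEmbedding.valuedFieldLanguage] M) :
    HahnStableEmbedding.UniformlyStablyEmbedded HahnStableEmbedding.valuedFieldLanguage
      (Set.range f) :=
  HahnStableEmbedding.uniformlyStablyEmbedded_range k M f
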